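/- **Model.** A trust-aware $K$-armed bandit consists of a probability law of reward vectors $(R(1),\dots,R(K))$ supported in $[0,1]^K$, a trust set $\mathcal T\subseteq[K]$, and an own policy $\pi^{\mathsf{own}}$ of the implementer. Write $r(k)=\mathbb E[R(k)]$ and $r^\star=\max_k r(k)$. Put $\alpha_1=\beta_1=1$. At each time $h=1,2,\dots$: * the policy-maker recommends an arm $a_h^{\mathsf{pm}}$, whose law depends only on the past observations $(a_i^{\mathsf{ac}},R_i(a_i^{\mathsf{ac}}),\chi_i)_{i<h}$; * the implementer draws an arm $a_h^{\mathsf{own}}\sim\pi_h^{\mathsf{own}}$, where $\pi_h^{\mathsf{own}}$ may depend arbitrarily (measurably) on the whole past and on $a_h^{\mathsf{pm}}$; * given the past, and independently of the two arms and of each other, $\chi_h\sim\mathsf{Bern}(t_h)$ with $t_h=\alpha_h/(\alpha_h+\beta_h)$, and the reward vector $R_h$ is drawn from the reward law (so the $R_h$ are i.i.d.); * the arm $a_h^{\mathsf{ac}}=a_h^{\mathsf{pm}}$ is pulled if $\chi_h=1$, and $a_h^{\mathsf{ac}}=a_h^{\mathsf{own}}$ if $\chi_h=0$; * $\alpha_{h+1}=\alpha_h+\mathbb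 1\{a_h^{\mathsf{pm}}\in\mathcal T\}$ and $\beta_{h+1}=\beta_h+\mathbb 1\{a_h^{\mathsf{pm}}\notin\mathcal T\}$. The instance is consistent if $r(k)=r^\star$ for some $k\in\mathcal T$. The expected regret over $H$ steps is $\mathbb E[\mathsf{reg}_H]=\mathbb E\big[\sum_{h=1}^H (r^\star-r(a_h^{\mathsf{ac}}))\big]$. **Trust-aware UCB.** The input is $K$ and $H$ only. Let $m=\lceil 30K^3\log H\rceil$ and $H_0=2mK$. *Stage 1.* For $h\le H_0$ recommend arm $\lceil h/(2m)\rceil$. Let $Y_k^{(1)}=\frac1m\sum_{i=1}^m\chi_{2m(k-1)+i}$ and $Y_k^{(2)}=\frac1m\sum_{i=m+1}^{2m}\chi_{2m(k-1)+i}$. Start from $\widehat{\mathcal T}=\varnothing$ and, for $k=1,\dots,K$ in this order, add $k$ to $\widehat{\mathcal T}$ if ($k=1$) $Y_1^{(1)}+Y_1^{(2)}\ge\frac12$, respectively ($k>1$) $Y_k^{(2)}-Y_k^{(1)}\ge\lambda_k(\widehat{\mathcal T})$, where $\lambda_k(\widehat{\mathcal T})$ is $\frac1{5k}$ if $|\widehat{\mathcal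 T}|=0$, $-\frac1{5k}$ if $|\widehat{\mathcal T}|=k-1$, and $0$ otherwise. *Stage 2.* For $H_0<h\le H$ recommend an arm maximizing $\mathsf{UCB}_h(a)$ over $a\in\widehat{\mathcal T}$, with ties broken uniformly at random (a uniformly random arm of $[K]$ if $\widehat{\mathcal T}=\varnothing$). Here $\mathsf{UCB}_{H_0+1}(a)=1$ and, for $h>H_0+1$, $$\mathsf{UCB}_h(a)=1\wedge\Big\{\frac1{N_h(a)}\sum_{i=H_0+1}^{h-1}R_i(a)\mathbb 1\{a_i^{\mathsf{ac}}=a\}+2\sqrt{\frac{\log H}{N_h(a)}}\Big\},\qquad N_h(a)=1\vee\sum_{i=H_0+1}^{h-1}\mathbb 1\{a_i^{\mathsf{ac}}=a\}.$$ **Theorem.** There are universal constants $C_1,C_2>0$ such that for all integers $K\ge2$ and $H\ge2$ and every consistent trust-aware $K$-armed bandit, the expected regret of trust-aware UCB satisfies $$\mathbb E[\mathsf{reg}_H]\le C_1\sqrt{KH\log H}+C_2K^4\log^2H .$$ The algorithm depends only on $K$, $H$ and the observations, not on $\mathcal T$, the trust levels $t_h$ or $\pi^{\mathsf{own}}$.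 -/

import Mathlib

open MeasureTheory ProbabilityTheory

noncomputable section

namespace TrustMAB

/-- What happens at one time step of the game with `K` arms:
`((a^pm, a^own), (χ, R))`, where `a^pm` is the recommended arm, `a^own` the arm drawn from the
implementer's own policy, `χ` tells whether the recommendation is followed, and `R` is the vector
of the rewards of all arms. -/
abbrev Step (K : ℕ) : Type := (Fin K × Fin K) × (Bool × (Fin K → ℝ))

/-- The recommended arm `a^pm`. -/
def Step.recommended {K : ℕ} (s : Step K) : Fin K := s.1.1

/-- The arm `a^ac` that is actually pulled: the recommended one if `χ = 1`, the implementer's own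
one if `χ = 0`. -/
def Step.pulled {K : ℕ} (s : Step K) : Fin K := if s.2.1 = true then s.1.1 else s.1.2

/-- What the policy-maker observes at one time step: `(a^ac, R(a^ac), χ)`. -/
abbrev Obs (K : ℕ) : Type := Fin K × ℝ × Bool

/-- The observation of the policy-maker at a time step. -/
def Step.obs {K : ℕ} (s : Step K) : Obs K := (s.pulled, s.2.2 s.pulled, s.2.1)

/-- The first `n` time steps of the game. Index `i : Fin n` stands for time `i + 1`. -/
abbrev History (K n : ℕ) : Type := Fin n → Step K

/-- The observations of the policy-maker along the first `n` time steps. -/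
def History.obs {K n : ℕ} (x : History K n) : Fin n → Obs K := fun i => (x i).obs

lemma measurable_pulled {K : ℕ} : Measurable (Step.pulled : Step K → Fin K) := by
  unfold Step.pulled
  refine Measurable.ite ?_ (by fun_prop) (by fun_prop)
  exact measurableSet_eq_fun (by fun_prop) measurable_const

lemma measurable_obs {K : ℕ} : Measurable (Step.obs : Step K → Obs K) := by
  refine measurable_pulled.prodMk (Measurable.prodMk ?_ (by fun_prop))
  have h : Measurable (fun p : Fin K × (Fin K → ℝ) => p.2 p.1) :=
    measurable_from_prod_countable_right fun a => measurable_pi_apply a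
  exact h.comp (measurable_pulled.prodMk (by fun_prop : Measurable fun s : Step K => s.2.2))

lemma measurable_historyObs {K n : ℕ} :
    Measurable (History.obs : History K n → Fin n → Obs K) :=
  measurable_pi_lambda _ fun i => measurable_obs.comp (measurable_pi_apply i)

/-- A (randomized) policy of the policy-maker: for every `n`, the law of the recommendation at time
`n + 1`, given the observations at the times `1, …, n` and nothing else. -/
structure Policy (K : ℕ) where
  /-- The law of the next recommendation. -/
  kernel : (n : ℕ) → Kernel (Fin n → Obs K) (Fin K)
  /-- Each of these laws is a probability distribution. -/
  markov : ∀ n, IsMarkovKernel (kernel n)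

/-- A trust-aware `K`-armed bandit: the law of the reward vectors, the trust set, and the own policy
of the implementer. The own policy may be randomized and may depend on the whole past and on the
current recommendation. -/
structure Bandit (K : ℕ) where
  /-- The common law of the i.i.d. reward vectors `(R_h(1), …, R_h(K))`. -/
  rewardLaw : Measure (Fin K → ℝ)
  /-- It is a probability measure. -/
  prob : IsProbabilityMeasure rewardLaw
  /-- The rewards lie in `[0, 1]`. -/
  reward_mem : ∀ᵐ R ∂rewardLaw, ∀ k, R k ∈ Set.Icc (0 : ℝ) 1
  /-- The trust set. -/
  trustSet : Finset (Fin K)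
  /-- The own policy: the law of `a^own` at time `n + 1`, given the first `n` steps and the
  recommendation at time `n + 1`. -/
  own : (n : ℕ) → Kernel (History K n × Fin K) (Fin K)
  /-- Each of these laws is a probability distribution. -/
  own_markov : ∀ n, IsMarkovKernel (own n)

attribute [instance] Policy.markov Bandit.prob Bandit.own_markov

namespace Bandit

variable {K : ℕ} (B : Bandit K)

/-- The expected reward `r(k)` of arm `k`. -/
def mean (k : Fin K) : ℝ := ∫ R, R k ∂B.rewardLaw

/-- The maximal expected reward `r^⋆`. -/
def best : ℝ := ⨆ k, B.mean k

/-- Consistency: the trust set contains at least one optimal arm. -/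
def Consistent : Prop := ∃ k ∈ B.trustSet, B.mean k = B.best

/-- `α` after `n` steps: one plus the number of recommendations inside the trust set. -/
def alpha {n : ℕ} (x : History K n) : ℝ := 1 + ∑ i, if (x i).recommended ∈ B.trustSet then (1 : ℝ) else 0

/-- `β` after `n` steps: one plus the number of recommendations outside the trust set. -/
def beta {n : ℕ} (x : History K n) : ℝ := 1 + ∑ i, if (x i).recommended ∉ B.trustSet then (1 : ℝ) else 0

/-- The trust level at time `n + 1`, given the first `n` steps. -/
def trust {n : ℕ} (x : History K n) : ℝ := B.alpha x / (B.alpha x + B.beta x)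

lemma alpha_pos {n : ℕ} (x : History K n) : 0 < B.alpha x := by
  unfold alpha
  have : 0 ≤ ∑ i, if (x i).recommended ∈ B.trustSet then (1 : ℝ) else 0 :=
    Finset.sum_nonneg fun i _ => by split_ifs <;> norm_num
  linarith

lemma beta_pos {n : ℕ} (x : History K n) : 0 < B.beta x := by
  unfold beta
  have : 0 ≤ ∑ i, if (x i).recommended ∉ B.trustSet then (1 : ℝ) else 0 :=
    Finset.sum_nonneg fun i _ => by split_ifs <;> norm_num
  linarith

lemma trust_nonneg {n : ℕ} (x : History K n) : 0 ≤ B.trust x :=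
  div_nonneg (B.alpha_pos x).le (add_pos (B.alpha_pos x) (B.beta_pos x)).le

lemma trust_le_one {n : ℕ} (x : History K n) : B.trust x ≤ 1 := by
  have h1 := B.alpha_pos x
  have h2 := B.beta_pos x
  exact (div_le_one (by linarith)).2 (by linarith)

lemma measurable_trust {n : ℕ} : Measurable (B.trust : History K n → ℝ) := by
  have h (p : Fin K → Prop) [DecidablePred p] (i : Fin n) :
      Measurable fun x : History K n => if p (x i).recommended then (1 : ℝ) else 0 := by
    have h1 : Measurable fun x : History K n => (x i).recommended := by
      unfold Step.recommended
      fun_prop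
    have h2 : Measurable fun a : Fin K => if p a then (1 : ℝ) else 0 := Measurable.of_discrete
    exact h2.comp h1
  have ha : Measurable (B.alpha : History K n → ℝ) :=
    measurable_const.add (Finset.measurable_sum _ fun i _ => h (· ∈ B.trustSet) i)
  have hb : Measurable (B.beta : History K n → ℝ) :=
    measurable_const.add (Finset.measurable_sum _ fun i _ => h (· ∉ B.trustSet) i)
  exact ha.div (ha.add hb)

/-- The law of `χ` at time `n + 1`, given the first `n` steps: Bernoulli with the trust level as its
parameter. -/
def follow (n : ℕ) : Kernel (History K n) Bool where
  toFun x := ENNReal.ofReal (B.trust x) • Measure.dirac true +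
    ENNReal.ofReal (1 - B.trust x) • Measure.dirac false
  measurable' := by
    refine Measure.measurable_of_measurable_coe _ fun s _ => ?_
    simp only [Measure.coe_add, Measure.coe_smul, Pi.add_apply, Pi.smul_apply, smul_eq_mul]
    have := B.measurable_trust (n := n)
    fun_prop

instance (n : ℕ) : IsMarkovKernel (B.follow n) where
  isProbabilityMeasure x := ⟨by
    change (ENNReal.ofReal (B.trust x) • Measure.dirac true +
      ENNReal.ofReal (1 - B.trust x) • Measure.dirac false : Measure Bool) Set.univ = 1
    simp only [Measure.coe_add, Measure.coe_smul, Pi.add_apply, Pi.smul_apply, smul_eq_mul,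
      measure_univ, mul_one]
    rw [← ENNReal.ofReal_add (B.trust_nonneg x) (by linarith [B.trust_le_one x])]
    simp⟩

/-- The law of the time step `n + 1`, given the first `n` steps, under the policy `π` of the
policy-maker: the recommendation is drawn from `π`, then the own arm from the own policy, and `χ`
and the rewards are drawn independently of both and of each other. -/
def step (π : Policy K) (n : ℕ) : Kernel (History K n) (Step K) :=
  ((π.kernel n).comap History.obs measurable_historyObs ⊗ₖ B.own n) ×ₖ
    (B.follow n ×ₖ Kernel.const (History K n) B.rewardLaw)

instance (π : Policy K) (n : ℕ) : IsMarkovKernel (B.step π n) := by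
  unfold step
  infer_instance

/-- The law of the first `n` steps of the game under the policy `π`. -/
def law (π : Policy K) : (n : ℕ) → Measure (History K n)
  | 0 => Measure.dirac Fin.elim0
  | n + 1 => (law π n ⊗ₘ B.step π n).map fun p => Fin.snoc (α := fun _ => Step K) p.1 p.2

lemma measurable_snoc {n : ℕ} : Measurable fun p : History K n × Step K =>
    (Fin.snoc (α := fun _ => Step K) p.1 p.2 : History K (n + 1)) := by
  refine measurable_pi_lambda _ fun i => ?_
  refine Fin.lastCases ?_ (fun j => ?_) i
  · simpa using measurable_snd
  · simp only [Fin.snoc_castSucc]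
    exact (measurable_pi_apply j).comp measurable_fst

instance isProbabilityMeasure_law (π : Policy K) (n : ℕ) : IsProbabilityMeasure (B.law π n) := by
  induction n with
  | zero => exact Measure.dirac.isProbabilityMeasure
  | succ n ih => exact Measure.isProbabilityMeasure_map measurable_snoc.aemeasurable

/-- The regret accumulated along the first `n` steps. -/
def regret {n : ℕ} (x : History K n) : ℝ := ∑ i, (B.best - B.mean (x i).pulled)

/-- The expected regret of the policy `π` over `n` steps. -/
def expectedRegret (π : Policy K) (n : ℕ) : ℝ := ∫ x, B.regret x ∂B.law π n

/-- The regret is integrable, so that its expectation is not a default value. -/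
lemma integrable_regret (π : Policy K) (n : ℕ) :
    Integrable (B.regret : History K n → ℝ) (B.law π n) := by
  refine integrable_finsetSum _ fun i _ => ?_
  have h1 : Measurable fun x : History K n => (x i).pulled :=
    measurable_pulled.comp (measurable_pi_apply i)
  have h2 : Measurable fun a : Fin K => B.best - B.mean a := Measurable.of_discrete
  refine Integrable.of_bound (h2.comp h1).aestronglyMeasurable
    (∑ a, ‖B.best - B.mean a‖) (ae_of_all _ fun x => ?_)
  exact Finset.single_le_sum (f := fun a => ‖B.best - B.mean a‖)
    (fun a _ => norm_nonneg _) (Finset.mem_univ (x i).pulled)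

end Bandit

/-! The two-stage trust-aware UCB algorithm. Arms and times are counted from `0`, so that arm `k`
below is the `(k + 1)`-st arm, and index `i` stands for time `i + 1`. -/

/-- Half the length of a round of the first stage, `30 K³ log H`, rounded up. -/
def halfRound (K H : ℕ) : ℕ := ⌈30 * (K : ℝ) ^ 3 * Real.log H⌉₊

/-- The length `H₀ = 2 m K` of the first stage. -/
def stageOne (K H : ℕ) : ℕ := 2 * halfRound K H * K

/-- The `i`-th indicator `χ`, as a number. -/
def chi {n : ℕ} (c : Fin n → Bool) (i : ℕ) : ℝ :=
  if h : i < n then (if c ⟨i, h⟩ = true then 1 else 0) else 0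

/-- The frequency of followed recommendations in the first half of round `k`. -/
def freqOne {n : ℕ} (m : ℕ) (c : Fin n → Bool) (k : ℕ) : ℝ :=
  (1 / (m : ℝ)) * ∑ i ∈ Finset.range m, chi c (2 * m * k + i)

/-- The frequency of followed recommendations in the second half of round `k`. -/
def freqTwo {n : ℕ} (m : ℕ) (c : Fin n → Bool) (k : ℕ) : ℝ :=
  (1 / (m : ℝ)) * ∑ i ∈ Finset.Ico m (2 * m), chi c (2 * m * k + i)

/-- The comparison threshold for the arm `k`, given the current estimate of the trust set. -/
def threshold (k : ℕ) (T : Finset ℕ) : ℝ :=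
  if T.card = 0 then 1 / (5 * ((k : ℝ) + 1))
  else if T.card = k then -(1 / (5 * ((k : ℝ) + 1)))
  else 0

/-- The test that decides whether the arm `k` is added to the estimate `T`. -/
def Accept {n : ℕ} (m : ℕ) (c : Fin n → Bool) (k : ℕ) (T : Finset ℕ) : Prop :=
  if k = 0 then 1 / 2 ≤ freqOne m c 0 + freqTwo m c 0
  else threshold k T ≤ freqTwo m c k - freqOne m c k

open Classical in
/-- The estimated trust set after the first `k` rounds. -/
def estimate {n : ℕ} (m : ℕ) (c : Fin n → Bool) : ℕ → Finset ℕ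
  | 0 => ∅
  | k + 1 => if Accept m c k (estimate m c k) then insert k (estimate m c k) else estimate m c k

/-- The estimated trust set at the end of the first stage, computed from the indicators `χ`. -/
def estTrustSet (K H : ℕ) {n : ℕ} (c : Fin n → Bool) : Finset (Fin K) :=
  Finset.univ.filter fun a => (a : ℕ) ∈ estimate (halfRound K H) c K

/-- The number of pulls of arm `a` in the second stage so far, but at least `1`. -/
def pulls (K H : ℕ) {n : ℕ} (o : Fin n → Obs K) (a : Fin K) : ℝ :=
  max 1 (∑ i : Fin n, if stageOne K H ≤ (i : ℕ) ∧ (o i).1 = a then (1 : ℝ) else 0)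

/-- The upper confidence bound of arm `a` at time `n + 1`, in the second stage. -/
def ucb (K H : ℕ) {n : ℕ} (o : Fin n → Obs K) (a : Fin K) : ℝ :=
  if n = stageOne K H then 1
  else min 1 ((1 / pulls K H o a) *
      (∑ i : Fin n, if stageOne K H ≤ (i : ℕ) ∧ (o i).1 = a then (o i).2.1 else 0) +
    2 * Real.sqrt (Real.log H / pulls K H o a))

/-- The maximizers of `u` over `T`; all arms if `T` is empty. -/
def maximizers {K : ℕ} (T : Finset (Fin K)) (u : Fin K → ℝ) : Finset (Fin K) :=
  open Classical in
  if T = ∅ then Finset.univ else T.filter fun a => ∀ b ∈ T, u b ≤ u a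

/-- The set of arms among which the algorithm draws uniformly the recommendation at time `n + 1`:
in round `k` of the first stage only the arm `k`, in the second stage the maximizers of the upper
confidence bound over the estimated trust set. -/
def candidates (K H n : ℕ) (o : Fin n → Obs K) : Finset (Fin K) :=
  if n < stageOne K H then Finset.univ.filter fun a => (a : ℕ) = n / (2 * halfRound K H)
  else maximizers (estTrustSet K H fun i => (o i).2.2) (ucb K H o)

lemma candidates_nonempty {K H n : ℕ} (hK : 2 ≤ K) (o : Fin n → Obs K) :
    (candidates K H n o).Nonempty := by
  have : NeZero K := ⟨by omega⟩
  unfold candidates maximizers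
  split_ifs with h1 h2
  · exact ⟨⟨n / (2 * halfRound K H), Nat.div_lt_of_lt_mul h1⟩, by simp⟩
  · exact Finset.univ_nonempty
  · obtain ⟨a, ha, hb⟩ := Finset.exists_max_image _ (ucb K H o) (Finset.nonempty_iff_ne_empty.2 h2)
    exact ⟨a, Finset.mem_filter.2 ⟨ha, hb⟩⟩

lemma measurable_ucb (K H n : ℕ) : Measurable (ucb K H : (Fin n → Obs K) → Fin K → ℝ) := by
  refine measurable_pi_lambda _ fun a => ?_
  have hs (i : Fin n) : MeasurableSet
      {o : Fin n → Obs K | stageOne K H ≤ (i : ℕ) ∧ (o i).1 = a} :=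
    (MeasurableSet.const _).inter (measurableSet_eq_fun (by fun_prop) measurable_const)
  have hp : Measurable fun o : Fin n → Obs K => pulls K H o a :=
    measurable_const.max (Finset.measurable_sum _ fun i _ =>
      Measurable.ite (hs i) measurable_const measurable_const)
  have hr : Measurable fun o : Fin n → Obs K =>
      ∑ i : Fin n, if stageOne K H ≤ (i : ℕ) ∧ (o i).1 = a then (o i).2.1 else 0 :=
    Finset.measurable_sum _ fun i _ => Measurable.ite (hs i) (by fun_prop) measurable_const
  unfold ucb
  by_cases h : n = stageOne K H
  · simp only [h, if_true]
    exact measurable_const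
  · simp only [h, if_false]
    fun_prop

lemma measurable_candidates (K H n : ℕ) : Measurable[_, ⊤] (candidates K H n) := by
  let _ : MeasurableSpace (Finset (Fin K)) := ⊤
  unfold candidates
  by_cases h : n < stageOne K H
  · simp only [h, if_true]
    exact measurable_const
  · simp only [h, if_false]
    have hT : Measurable fun o : Fin n → Obs K => estTrustSet K H fun i => (o i).2.2 := by
      have h1 : Measurable fun o : Fin n → Obs K => fun i => (o i).2.2 := by fun_prop
      have h2 : Measurable (estTrustSet K H : (Fin n → Bool) → Finset (Fin K)) :=
        Measurable.of_discrete
      exact h2.comp h1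
    have hM : Measurable fun p : Finset (Fin K) × (Fin K → ℝ) => maximizers p.1 p.2 := by
      refine measurable_from_prod_countable_right fun T => ?_
      refine measurable_to_countable' fun S => ?_
      have : (fun u : Fin K → ℝ => maximizers T u) ⁻¹' {S} =
          ⋂ a, {u | a ∈ maximizers T u ↔ a ∈ S} := by
        ext u
        simp [Finset.ext_iff]
      change MeasurableSet ((fun u : Fin K → ℝ => maximizers T u) ⁻¹' {S})
      rw [this]
      refine MeasurableSet.iInter fun a => ?_
      refine MeasurableSet.iff ?_ (MeasurableSet.const _)
      by_cases hT : T = ∅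
      · simp [maximizers, hT]
      · have : {u : Fin K → ℝ | a ∈ maximizers T u} =
            {_u | a ∈ T} ∩ ⋂ b ∈ T, {u | u b ≤ u a} := by
          ext u
          simp [maximizers, hT]
        change MeasurableSet {u : Fin K → ℝ | a ∈ maximizers T u}
        rw [this]
        refine (MeasurableSet.const _).inter ?_
        exact MeasurableSet.iInter fun b => MeasurableSet.iInter fun _ =>
          measurableSet_le (measurable_pi_apply b) (measurable_pi_apply a)
    exact hM.comp (hT.prodMk (measurable_ucb K H n))

/-- The two-stage trust-aware UCB algorithm for `K` arms and the time horizon `H`. -/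
def trustAwareUCB (K H : ℕ) (hK : 2 ≤ K) : Policy K where
  kernel n :=
    { toFun := fun o => uniformOn (candidates K H n o : Set (Fin K))
      measurable' := by
        let _ : MeasurableSpace (Finset (Fin K)) := ⊤
        have h : Measurable fun S : Finset (Fin K) => uniformOn (S : Set (Fin K)) :=
          measurable_from_top
        exact h.comp (measurable_candidates K H n) }
  markov n := ⟨fun o => isProbabilityMeasure_uniformOn (Finset.finite_toSet _)
    (candidates_nonempty hK o)⟩

end TrustMAB

end

/-!
The regret splits into three parts. The first stage has length of order `K ^ 4 * log H` and costs at
most one per step. In the second stage, once the trust set has been identified, only trusted arms are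
recommended, so `β` stops growing (`one_sub_trust_le`): the recommendation at time `h` is disregarded
with probability at most of order `K ^ 4 * log H / h`, and summing over `h` gives the term
`K ^ 4 * log² H`. Whenever the recommendation is followed, the pulled arm maximizes the upper
confidence bound over a set that contains an optimal arm, by consistency. So the usual argument
applies: the regret of the step is at most the width of the confidence interval (`ucb_bounds`), and
the widths sum up to order `√(K * H * log H)` (`sum_one_div_sqrt_pulls_le`). The implementer's own
pulls enter the counts as well, which only narrows the intervals.

Two events of probability of order `K / H` have to be excluded. Both are controlled by one exponential
supermartingale (`lintegral_prod_le_one`, `law_le_exp_neg`), built along the recursion that defines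
the law of the game. As an own policy that depends on the past and on the recommendation influences
neither the conditional law of `χ` nor that of the reward vector, it causes no difficulty.

* Some empirical mean leaves its confidence interval (`law_deviates_le`). The own policy makes
  the number of pulls random, hence a union bound over its possible values.
* Some arm is misclassified in the first stage (`law_estTrustSet_ne`). There the recommendations are
  deterministic, and so is the trust level: it moves towards the class (trusted or not) of the arm
  of the round (`ownShare_gap`). The margin of the test of arm `k` over its threshold is of order
  `b / k²`, where `b` is the number of earlier arms of the other class, and it is of order `1 / k`
  where `b` is `0` or maximal, owing to the choice of the threshold. A margin of order `1 / k²` is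
  too small for Hoeffding's inequality with `m` of order `K³ * log H`, but then the variance of `χ`
  is at most of order `b / k`, and Bernstein's inequality suffices (`exists_exponent`).
-/

noncomputable section

namespace TrustMAB

open scoped ENNReal

/-! ### The law of the game -/

/-- The first `i` steps of a history of length `n`. -/
def History.take {K n : ℕ} (x : History K n) (i : ℕ) (h : i ≤ n) : History K i :=
  fun j => x (Fin.castLE h j)

lemma History.measurable_take {K n i : ℕ} (h : i ≤ n) :
    Measurable fun x : History K n => x.take i h :=
  measurable_pi_lambda _ fun _ => measurable_pi_apply _

lemma History.measurable_take_apply {K : ℕ} {β : Type*} [MeasurableSpace β] {n N : ℕ} (h : n < N)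
    {f : History K n → Step K → β} (hf : Measurable (Function.uncurry f)) :
    Measurable fun x : History K N => f (x.take n h.le) (x ⟨n, h⟩) :=
  hf.comp ((History.measurable_take h.le).prodMk (measurable_pi_apply (⟨n, h⟩ : Fin N)))

lemma History.take_snoc {K n i : ℕ} (x : History K n) (s : Step K) (h : i ≤ n) :
    History.take (Fin.snoc (α := fun _ => Step K) x s : History K (n + 1)) i
      (h.trans n.le_succ) = x.take i h := by
  funext j
  exact Fin.snoc_castSucc (α := fun _ => Step K) s x (Fin.castLE h j)

lemma History.take_self {K n : ℕ} (x : History K n) : x.take n le_rfl = x := rfl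

namespace Bandit

variable {K : ℕ} (B : Bandit K) (π : Policy K)

lemma lintegral_law_succ (n : ℕ) {f : History K (n + 1) → ℝ≥0∞} (hf : Measurable f) :
    ∫⁻ y, f y ∂B.law π (n + 1) =
      ∫⁻ x, ∫⁻ s, f (Fin.snoc (α := fun _ => Step K) x s) ∂B.step π n x ∂B.law π n := by
  have h : Measurable fun p : History K n × Step K =>
      f (Fin.snoc (α := fun _ => Step K) p.1 p.2) := hf.comp measurable_snoc
  rw [law, lintegral_map hf measurable_snoc, Measure.lintegral_compProd h]

/-- The laws of the histories of different lengths are consistent. -/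
lemma map_take_law {n N : ℕ} (h : n ≤ N) :
    (B.law π N).map (fun x => x.take n h) = B.law π n := by
  induction N, h using Nat.le_induction with
  | base => exact Measure.map_id
  | succ N h ih =>
    conv_rhs => rw [← ih]
    refine Measure.ext_of_lintegral _ fun f hf => ?_
    have h1 : Measurable fun x : History K (N + 1) => f (x.take n (h.trans N.le_succ)) :=
      hf.comp (History.measurable_take _)
    rw [lintegral_map hf (History.measurable_take _), lintegral_map hf (History.measurable_take _),
      lintegral_law_succ _ _ _ h1]
    simp_rw [History.take_snoc _ _ h]
    simp

/-- The expectation of a function of the step `n + 1` and of the steps before it. -/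
lemma lintegral_law_take {n N : ℕ} (h : n < N) {f : History K n → Step K → ℝ≥0∞}
    (hf : Measurable (Function.uncurry f)) :
    ∫⁻ x, f (x.take n h.le) (x ⟨n, h⟩) ∂B.law π N =
      ∫⁻ x, ∫⁻ s, f x s ∂B.step π n x ∂B.law π n := by
  have hg : Measurable fun y : History K (n + 1) => f (y.take n n.le_succ) (y (Fin.last n)) :=
    hf.comp ((History.measurable_take _).prodMk (measurable_pi_apply _))
  have h1 : ∫⁻ x, f (x.take n h.le) (x ⟨n, h⟩) ∂B.law π N =
      ∫⁻ y, f (y.take n n.le_succ) (y (Fin.last n)) ∂B.law π (n + 1) := by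
    rw [← B.map_take_law π (Nat.succ_le_of_lt h), lintegral_map hg (History.measurable_take _)]
    rfl
  rw [h1, lintegral_law_succ _ _ _ hg]
  simp_rw [History.take_snoc _ _ le_rfl, History.take_self, Fin.snoc_last]

/-- A product of nonnegative factors, each of conditional expectation at most one given the past,
has expectation at most one. This is the supermartingale behind all the tail bounds. -/
lemma lintegral_prod_le_one {g : (n : ℕ) → History K n → Step K → ℝ≥0∞}
    (hg : ∀ n, Measurable (Function.uncurry (g n)))
    (h1 : ∀ n x, ∫⁻ s, g n x s ∂B.step π n x ≤ 1) (n : ℕ) :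
    ∫⁻ x : History K n, ∏ i : Fin n, g i (x.take i i.is_lt.le) (x i) ∂B.law π n ≤ 1 := by
  have hm (n : ℕ) : Measurable fun x : History K n =>
      ∏ i : Fin n, g i (x.take i i.is_lt.le) (x i) :=
    Finset.measurable_prod _ fun i _ =>
      (hg i).comp ((History.measurable_take _).prodMk (measurable_pi_apply _))
  induction n with
  | zero => simp
  | succ n ih =>
    rw [lintegral_law_succ _ _ _ (hm _)]
    refine le_trans (lintegral_mono fun x => ?_) ih
    have h2 (s : Step K) : ∏ i : Fin (n + 1), g i
          (History.take (Fin.snoc (α := fun _ => Step K) x s : History K (n + 1)) i i.is_lt.le)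
          (Fin.snoc (α := fun _ => Step K) x s i) =
        (∏ i : Fin n, g i (x.take i i.is_lt.le) (x i)) * g n x s := by
      rw [Fin.prod_univ_castSucc]
      congr 1
      · refine Finset.prod_congr rfl fun i _ => ?_
        rw [Fin.snoc_castSucc]
        exact congrArg (fun y => g i y (x i)) (History.take_snoc x s i.is_lt.le)
      · rw [Fin.snoc_last]
        exact congrArg (fun y => g n y s) (History.take_snoc x s le_rfl)
    simp_rw [h2]
    have h3 : Measurable fun s => g n x s := (hg n).comp measurable_prodMk_left
    rw [lintegral_const_mul _ h3]
    exact mul_le_of_le_one_right zero_le (h1 n x)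

/-- The exponential tail bound that comes from `lintegral_prod_le_one`. -/
lemma law_le_exp_neg {Z : (n : ℕ) → History K n → Step K → ℝ}
    (hZ : ∀ n, Measurable (Function.uncurry (Z n)))
    (h1 : ∀ n x, ∫⁻ s, ENNReal.ofReal (Real.exp (Z n x s)) ∂B.step π n x ≤ 1) (n : ℕ) (D : ℝ) :
    B.law π n {x | D ≤ ∑ i : Fin n, Z i (x.take i i.is_lt.le) (x i)} ≤
      ENNReal.ofReal (Real.exp (-D)) := by
  have hg (n : ℕ) : Measurable (Function.uncurry fun (x : History K n) s =>
      ENNReal.ofReal (Real.exp (Z n x s))) :=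
    (Real.measurable_exp.comp (hZ n)).ennreal_ofReal
  have h2 := B.lintegral_prod_le_one π hg h1 n
  have hm : Measurable fun x : History K n =>
      ∏ i : Fin n, ENNReal.ofReal (Real.exp (Z i (x.take i i.is_lt.le) (x i))) :=
    Finset.measurable_prod _ fun i _ =>
      (hg i).comp ((History.measurable_take _).prodMk (measurable_pi_apply _))
  have h3 := meas_ge_le_lintegral_div (μ := B.law π n) hm.aemeasurable
    (ε := ENNReal.ofReal (Real.exp D)) (by simp [Real.exp_pos]) ENNReal.ofReal_ne_top
  calc _ ≤ _ := measure_mono fun x hx => ?_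
    _ ≤ _ := h3
    _ ≤ 1 / ENNReal.ofReal (Real.exp D) := ENNReal.div_le_div_right h2 _
    _ = _ := by rw [Real.exp_neg, ENNReal.ofReal_inv_of_pos (Real.exp_pos D), one_div]
  simp only [Set.mem_ofPred_eq] at hx ⊢
  rw [← ENNReal.ofReal_prod_of_nonneg fun i _ => (Real.exp_pos _).le, ← Real.exp_sum]
  exact ENNReal.ofReal_le_ofReal (Real.exp_le_exp.2 hx)

/-- The four ingredients of a step are integrated one after the other, the rewards first. -/
lemma lintegral_step (n : ℕ) (x : History K n) {f : Step K → ℝ≥0∞} (hf : Measurable f) :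
    ∫⁻ s, f s ∂B.step π n x =
      ∫⁻ p, ∫⁻ c, ∫⁻ R, f (p, (c, R)) ∂B.rewardLaw ∂B.follow n x
        ∂((π.kernel n).comap History.obs measurable_historyObs ⊗ₖ B.own n) x := by
  rw [step, Kernel.lintegral_prod _ _ _ hf]
  refine lintegral_congr fun p => ?_
  have h : Measurable fun c : Bool × (Fin K → ℝ) => f (p, c) := hf.comp measurable_prodMk_left
  rw [Kernel.lintegral_prod _ _ _ h]
  simp

lemma lintegral_step_le_one_of_reward (n : ℕ) (x : History K n) {f : Step K → ℝ≥0∞}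
    (hf : Measurable f) (h : ∀ p c, ∫⁻ R, f (p, (c, R)) ∂B.rewardLaw ≤ 1) :
    ∫⁻ s, f s ∂B.step π n x ≤ 1 := by
  rw [lintegral_step _ _ _ _ hf]
  refine (lintegral_mono fun p => lintegral_mono fun c => h p c).trans ?_
  simp only [lintegral_const, measure_univ, mul_one, le_refl]

lemma lintegral_step_follow (n : ℕ) (x : History K n) {f : Bool → ℝ≥0∞} :
    ∫⁻ s, f s.2.1 ∂B.step π n x =
      ENNReal.ofReal (B.trust x) * f true + ENNReal.ofReal (1 - B.trust x) * f false := by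
  have hf : Measurable fun s : Step K => f s.2.1 :=
    (Measurable.of_discrete (f := f)).comp (by fun_prop)
  rw [lintegral_step _ _ _ _ hf]
  have h (g : Bool → ℝ≥0∞) : ∫⁻ c, g c ∂B.follow n x =
      ENNReal.ofReal (B.trust x) * g true + ENNReal.ofReal (1 - B.trust x) * g false := by
    change ∫⁻ c, g c ∂(ENNReal.ofReal (B.trust x) • Measure.dirac true +
      ENNReal.ofReal (1 - B.trust x) • Measure.dirac false) = _
    rw [lintegral_add_measure, lintegral_smul_measure, lintegral_smul_measure, lintegral_dirac,
      lintegral_dirac]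
    simp
  simp [h]

/-- Almost surely, a property of the recommendation that the policy guarantees given the
observations holds at all times. -/
lemma ae_recommended {P : (n : ℕ) → (Fin n → Obs K) → Fin K → Prop}
    (hP : ∀ n a, MeasurableSet {o | P n o a}) (h : ∀ n o, ∀ᵐ a ∂π.kernel n o, P n o a) (n : ℕ) :
    ∀ᵐ x ∂B.law π n, ∀ i : Fin n, P i (x.take i i.is_lt.le).obs (x i).recommended := by
  refine ae_all_iff.2 fun i => ?_
  have hm : Measurable (Function.uncurry fun (x : History K i) (s : Step K) =>
      Set.indicator {a | ¬ P i x.obs a} (fun _ => (1 : ℝ≥0∞)) s.recommended) := by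
    have h1 : Measurable (fun q : (Fin i → Obs K) × Fin K =>
        Set.indicator {a | ¬ P i q.1 a} (fun _ => (1 : ℝ≥0∞)) q.2) := by
      refine measurable_from_prod_countable_left fun a => ?_
      simp only [Set.indicator]
      exact Measurable.ite (hP i a).compl measurable_const measurable_const
    have h2 : Measurable (Step.recommended : Step K → Fin K) := by
      unfold Step.recommended; fun_prop
    exact h1.comp ((measurable_historyObs.comp measurable_fst).prodMk (h2.comp measurable_snd))
  have h0 := B.lintegral_law_take π i.is_lt hm
  have h3 : ∫⁻ x, ∫⁻ s, Set.indicator {a | ¬ P i x.obs a} (fun _ => (1 : ℝ≥0∞)) s.recommended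
      ∂B.step π i x ∂B.law π i = 0 := by
    refine (lintegral_congr fun x => ?_).trans lintegral_zero
    have h4 : (B.step π i x).map Step.recommended = π.kernel i x.obs := by
      have e1 : (B.step π i x).map Prod.fst =
          ((π.kernel i).comap History.obs measurable_historyObs ⊗ₖ B.own i) x := by
        rw [step, ← Kernel.fst_apply, Kernel.fst_prod]
      have e2 : ((((π.kernel i).comap History.obs measurable_historyObs ⊗ₖ B.own i) x)).map
          Prod.fst = π.kernel i x.obs := by
        rw [← Kernel.fst_apply, Kernel.fst_compProd, Kernel.comap_apply]
      rw [← e2, ← e1, Measure.map_map measurable_fst measurable_fst]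
      rfl
    rw [← lintegral_map (f := Set.indicator {a | ¬ P i x.obs a} (fun _ => (1 : ℝ≥0∞)))
      Measurable.of_discrete (by unfold Step.recommended; fun_prop), h4,
      lintegral_indicator_const (MeasurableSet.of_discrete), one_mul]
    exact h i x.obs
  have hm' : Measurable fun x : History K n =>
      Set.indicator {a | ¬ P i (x.take i i.is_lt.le).obs a} (fun _ => (1 : ℝ≥0∞))
        (x i).recommended :=
    hm.comp ((History.measurable_take i.is_lt.le).prodMk (measurable_pi_apply i))
  rw [h3, lintegral_eq_zero_iff hm'] at h0
  filter_upwards [h0] with x hx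
  by_contra hc
  simp [Set.indicator, hc] at hx

end Bandit

/-! ### Exponential moments of bounded variables -/

/-- Hoeffding's lemma. -/
lemma lintegral_exp_sub_mean_le_one {Ω : Type*} [MeasurableSpace Ω] {μ : Measure Ω}
    [IsProbabilityMeasure μ] {X : Ω → ℝ} (hX : AEMeasurable X μ)
    (h01 : ∀ᵐ ω ∂μ, X ω ∈ Set.Icc (0 : ℝ) 1) (s : ℝ) :
    ∫⁻ ω, ENNReal.ofReal (Real.exp (s * (X ω - ∫ ω', X ω' ∂μ) - s ^ 2 / 8)) ∂μ ≤ 1 := by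
  have h := hasSubgaussianMGF_of_mem_Icc hX h01
  have h1 := h.mgf_le s
  have h2 := h.integrable_exp_mul s
  have h3 (ω : Ω) : Real.exp (s * (X ω - ∫ ω', X ω' ∂μ) - s ^ 2 / 8) =
      Real.exp (s * (X ω - ∫ ω', X ω' ∂μ)) * Real.exp (-(s ^ 2 / 8)) := by
    rw [← Real.exp_add]; ring_nf
  simp_rw [h3]
  rw [← ofReal_integral_eq_lintegral_ofReal (h2.mul_const _)
    (ae_of_all _ fun ω => by positivity), integral_mul_const]
  refine ENNReal.ofReal_le_one.2 ?_
  have h4 : ∫ ω, Real.exp (s * (X ω - ∫ ω', X ω' ∂μ)) ∂μ ≤ Real.exp (s ^ 2 / 8) := by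
    refine h1.trans (Real.exp_le_exp.2 (le_of_eq ?_))
    norm_num
    ring
  calc _ ≤ Real.exp (s ^ 2 / 8) * Real.exp (-(s ^ 2 / 8)) :=
        mul_le_mul_of_nonneg_right h4 (Real.exp_pos _).le
    _ = 1 := by rw [← Real.exp_add]; simp

/-- An upper bound for the logarithmic moment generating function at `s` of a centred Bernoulli
variable with parameter `p`, valid for `|s| ≤ 1 / 4`: the better one of the bounds of Hoeffding
and of Bernstein. -/
def logMGFBound (s p : ℝ) : ℝ := min (s ^ 2 / 8) (3 / 5 * s ^ 2 * (p * (1 - p)))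

lemma logMGFBound_zero (p : ℝ) : logMGFBound 0 p = 0 := by simp [logMGFBound]

lemma logMGFBound_neg (s p : ℝ) : logMGFBound (-s) p = logMGFBound s p := by
  simp [logMGFBound]

lemma logMGFBound_one_sub (s p : ℝ) : logMGFBound s (1 - p) = logMGFBound s p := by
  unfold logMGFBound
  ring_nf

/-- A Taylor bound with a constant close to `1 / 2`. Its size matters: with the constant `1` the
Chernoff exponent of the tests may fall below `log H`. -/
lemma exp_le_quadratic {y : ℝ} (hy : |y| ≤ 1 / 4) : Real.exp y ≤ 1 + y + 3 / 5 * y ^ 2 := by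
  have h3 := Real.exp_bound (x := y) (by linarith) (n := 3) (by norm_num)
  have h4 := (abs_le.1 h3).2
  simp [Finset.sum_range_succ, Nat.factorial] at h4
  have h5 : |y| ^ 3 ≤ 1 / 4 * y ^ 2 := by
    rw [← sq_abs y]
    nlinarith [sq_nonneg |y|]
  nlinarith [sq_nonneg y]

namespace Bandit

variable {K : ℕ} (B : Bandit K) (π : Policy K)

lemma lintegral_follow_le_one (n : ℕ) (x : History K n) {s : ℝ} (hs : |s| ≤ 1 / 4) :
    ∫⁻ y, ENNReal.ofReal (Real.exp (s * ((if y.2.1 = true then 1 else 0) - B.trust x) -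
      logMGFBound s (B.trust x))) ∂B.step π n x ≤ 1 := by
  set t := B.trust x with ht
  have ht0 : 0 ≤ t := B.trust_nonneg x
  have ht1 : t ≤ 1 := B.trust_le_one x
  have key (v : ℝ) (hv : t * Real.exp (s * (1 - t)) + (1 - t) * Real.exp (s * (0 - t)) ≤
      Real.exp v) : t * Real.exp (s * (1 - t) - v) + (1 - t) * Real.exp (s * (0 - t) - v) ≤ 1 := by
    rw [Real.exp_sub, Real.exp_sub, ← mul_div_assoc, ← mul_div_assoc, ← add_div]
    exact (div_le_one (Real.exp_pos v)).2 hv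
  have hH : t * Real.exp (s * (1 - t)) + (1 - t) * Real.exp (s * (0 - t)) ≤
      Real.exp (s ^ 2 / 8) := by
    have h1 := lintegral_exp_sub_mean_le_one (μ := B.follow n x)
      (X := fun c : Bool => if c = true then (1 : ℝ) else 0) (Measurable.of_discrete.aemeasurable)
      (ae_of_all _ fun c => by cases c <;> simp) s
    have h2 (g : Bool → ℝ) : ∫ c, g c ∂B.follow n x = t * g true + (1 - t) * g false := by
      change ∫ c, g c ∂(ENNReal.ofReal (B.trust x) • Measure.dirac true +
        ENNReal.ofReal (1 - B.trust x) • Measure.dirac false) = _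
      rw [integral_add_measure ((integrable_dirac (by simp)).smul_measure (by simp))
          ((integrable_dirac (by simp)).smul_measure (by simp)),
        integral_smul_measure, integral_smul_measure, integral_dirac, integral_dirac,
        ENNReal.toReal_ofReal ht0, ENNReal.toReal_ofReal (by linarith)]
      rfl
    rw [← ofReal_integral_eq_lintegral_ofReal .of_finite (ae_of_all _ fun c => (Real.exp_pos _).le),
      h2, h2] at h1
    have h3 := ENNReal.ofReal_le_one.1 h1
    simp only [if_true, Bool.false_eq_true, if_false, mul_one, mul_zero, add_zero] at h3
    rw [Real.exp_sub, Real.exp_sub, ← mul_div_assoc, ← mul_div_assoc, ← add_div,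
      div_le_one (Real.exp_pos _)] at h3
    exact h3
  have hB : t * Real.exp (s * (1 - t)) + (1 - t) * Real.exp (s * (0 - t)) ≤
      Real.exp (3 / 5 * s ^ 2 * (t * (1 - t))) := by
    have e1 := exp_le_quadratic (y := s * (1 - t)) (by
      rw [abs_mul, abs_of_nonneg (by linarith : 0 ≤ 1 - t)]
      nlinarith [abs_nonneg s])
    have e2 := exp_le_quadratic (y := s * (0 - t)) (by
      rw [abs_mul, zero_sub, abs_neg, abs_of_nonneg ht0]
      nlinarith [abs_nonneg s])
    have e3 := Real.add_one_le_exp (3 / 5 * s ^ 2 * (t * (1 - t)))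
    have e4 := mul_le_mul_of_nonneg_left e1 ht0
    have e5 := mul_le_mul_of_nonneg_left e2 (by linarith : 0 ≤ 1 - t)
    refine le_trans (add_le_add e4 e5) (le_trans (le_of_eq ?_) e3)
    ring
  have hV : t * Real.exp (s * (1 - t)) + (1 - t) * Real.exp (s * (0 - t)) ≤
      Real.exp (logMGFBound s t) := by
    unfold logMGFBound
    rcases min_choice (s ^ 2 / 8) (3 / 5 * s ^ 2 * (t * (1 - t))) with h | h <;> rw [h]
    exacts [hH, hB]
  rw [B.lintegral_step_follow π n x (f := fun c => ENNReal.ofReal (Real.exp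
    (s * ((if c = true then 1 else 0) - t) - logMGFBound s t))), ← ht]
  simp only [if_true, Bool.false_eq_true, if_false]
  rw [← ENNReal.ofReal_mul ht0, ← ENNReal.ofReal_mul (by linarith : 0 ≤ 1 - t),
    ← ENNReal.ofReal_add (by positivity) (mul_nonneg (by linarith) (Real.exp_pos _).le)]
  exact ENNReal.ofReal_le_one.2 (key _ hV)

/-- The tail bound for weighted sums of the centred indicators `χ`. -/
lemma law_follow_le (n : ℕ) (w : ℕ → ℝ) (hw : ∀ i, |w i| ≤ 1 / 4) (D : ℝ) :
    B.law π n {x | D ≤ ∑ i : Fin n, (w i * ((if (x i).2.1 = true then 1 else 0) -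
      B.trust (x.take i i.is_lt.le)) - logMGFBound (w i) (B.trust (x.take i i.is_lt.le)))} ≤
      ENNReal.ofReal (Real.exp (-D)) := by
  refine B.law_le_exp_neg π (Z := fun i x s => w i * ((if s.2.1 = true then 1 else 0) -
      B.trust x) - logMGFBound (w i) (B.trust x)) (fun i => ?_)
    (fun i x => B.lintegral_follow_le_one π i x (hw i)) n D
  have h1 : Measurable fun q : History K i × Step K => B.trust q.1 :=
    B.measurable_trust.comp measurable_fst
  have h2 : Measurable fun q : History K i × Step K => if q.2.2.1 = true then (1 : ℝ) else 0 :=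
    (Measurable.of_discrete (f := fun c : Bool => if c = true then (1 : ℝ) else 0)).comp
      (by fun_prop : Measurable fun q : History K i × Step K => q.2.2.1)
  unfold logMGFBound Function.uncurry
  fun_prop

end Bandit

/-! ### The trust level in a round of the first stage -/

/-- The own class of an arm is the trust set if the arm lies in it, and its complement otherwise.
Suppose that `a` of the first `k` arms belong to the class of the arm `k`. Then this is the share of
the class in `α + β` before the step `2mk + l + 1` of the first stage. -/
def ownShare (m k a l : ℕ) : ℝ := (1 + 2 * m * a + l) / (2 + 2 * m * k + l)

lemma ownShare_nonneg (m k a l : ℕ) : 0 ≤ ownShare m k a l := by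
  unfold ownShare; positivity

lemma one_sub_ownShare {m k a b : ℕ} (h : a + b = k) (l : ℕ) :
    1 - ownShare m k a l = (1 + 2 * m * b) / (2 + 2 * m * k + l) := by
  have : (2 + 2 * m * k + l : ℝ) ≠ 0 := by positivity
  rw [ownShare, eq_div_iff this, sub_mul, div_mul_cancel₀ _ this, ← h]
  push_cast
  ring

/-- The test threshold for the arm `k`, in terms of the number `a` of arms of its class among the
first `k` ones, and with the sign of the class. -/
def signedThreshold (k a : ℕ) : ℝ :=
  if a = 0 then 1 / (5 * ((k : ℝ) + 1)) else if a = k then -(1 / (5 * ((k : ℝ) + 1))) else 0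

/-- The trust moves towards the class of the recommended arm during a round, by an amount
proportional to the size of the other class. -/
lemma ownShare_gap {m k a b : ℕ} (h : a + b = k) :
    m * ((1 + 2 * m * b) * m / ((2 * m * k + m + 1) * (2 * m * k + 2 * m + 1))) ≤
      ∑ l ∈ Finset.Ico m (2 * m), ownShare m k a l - ∑ l ∈ Finset.range m, ownShare m k a l := by
  rw [Finset.sum_Ico_eq_sum_range, (by omega : 2 * m - m = m), ← Finset.sum_sub_distrib]
  have := Finset.card_nsmul_le_sum (Finset.range m)
    (fun l => ownShare m k a (m + l) - ownShare m k a l)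
    ((1 + 2 * m * b) * m / ((2 * m * k + m + 1) * (2 * m * k + 2 * m + 1)) : ℝ) fun l hl => ?_
  · simpa using this
  have hl : (l : ℝ) + 1 ≤ m := by exact_mod_cast Finset.mem_range.1 hl
  have e : ownShare m k a (m + l) - ownShare m k a l =
      (1 + 2 * m * b) * m / ((2 + 2 * m * k + l) * (2 + 2 * m * k + (m + l))) := by
    have h1 : (2 + 2 * m * k + l : ℝ) ≠ 0 := by positivity
    have h2 : (2 + 2 * m * k + (m + l) : ℝ) ≠ 0 := by positivity
    unfold ownShare
    subst h
    push_cast at *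
    field_simp
    ring
  rw [e]
  have h3 : (0 : ℝ) ≤ m * k := by positivity
  refine div_le_div_of_nonneg_left (by positivity) (by positivity) ?_
  exact mul_le_mul (by linarith) (by linarith) (by positivity) (by positivity)

lemma sum_logMGFBound_le (n : ℕ) (s : ℝ) (p : ℕ → ℝ) :
    ∑ l ∈ Finset.range n, logMGFBound s (p l) ≤ n * (s ^ 2 / 8) := by
  have := Finset.sum_le_card_nsmul (Finset.range n) (fun l => logMGFBound s (p l)) (s ^ 2 / 8)
    fun l _ => min_le_left _ _
  simpa using this

/-- In the first round nearly all of the trust moves to the class of the arm. -/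
lemma sum_ownShare_zero {m : ℕ} (hm : 100 ≤ m) :
    (5 / 3 : ℝ) * m ≤ ∑ l ∈ Finset.range (2 * m), ownShare m 0 0 l := by
  have h1 : ∀ l ∈ Finset.range (2 * m),
      (7 / 8 : ℝ) - (if l < 6 then 3 / 8 else 0) ≤ ownShare m 0 0 l := by
    intro l _
    have h0 : (0 : ℝ) ≤ l := Nat.cast_nonneg l
    unfold ownShare
    rw [le_div_iff₀ (by positivity)]
    split_ifs with h
    · push_cast
      linarith
    · have : (6 : ℝ) ≤ l := by exact_mod_cast not_lt.1 h
      push_cast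
      linarith
  refine le_trans ?_ (Finset.sum_le_sum h1)
  have h2 : (Finset.range (2 * m)).filter (· < 6) = Finset.range 6 := by
    ext l; simp; omega
  rw [Finset.sum_sub_distrib, ← Finset.sum_filter, h2]
  have : (100 : ℝ) ≤ m := by exact_mod_cast hm
  simp
  linarith

/-- The Chernoff exponent of the test of the first arm is at least `L`. A wrong test means that the
trust has gone to the class of the arm at most `3 / 2 * m` times out of `2 * m`. -/
lemma exists_exponent_zero {m : ℕ} {L : ℝ} (hm : 100 ≤ m) (hL : 240 * L ≤ m) :
    ∃ s : ℝ, 0 ≤ s ∧ s ≤ 1 / 4 ∧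
      ∑ l ∈ Finset.range (2 * m), logMGFBound s (ownShare m 0 0 l) + L ≤
        s * (∑ l ∈ Finset.range (2 * m), ownShare m 0 0 l - 3 / 2 * m) := by
  refine ⟨1 / 4, by norm_num, le_rfl, ?_⟩
  have h1 := sum_ownShare_zero hm
  have h2 := sum_logMGFBound_le (2 * m) (1 / 4) (ownShare m 0 0)
  have : (100 : ℝ) ≤ m := by exact_mod_cast hm
  push_cast at h2
  linarith

/-- The Chernoff exponent of the test of an arm `k ≥ 1` is at least `L`. If the other class is empty
or all of the first `k` arms are in it, then the threshold leaves a margin of order `1 / k`, for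
which Hoeffding's bound is good enough. Otherwise the margin may be of order `1 / k²` only, but the
variance is then small, of order `b / k`. -/
lemma exists_exponent {m k a b : ℕ} {L : ℝ} (h : a + b = k) (hk : 1 ≤ k) (hm : 100 ≤ m)
    (hL0 : 0 ≤ L) (hL : 30 * ((k : ℝ) + 1) ^ 3 * L ≤ m) :
    ∃ s : ℝ, 0 ≤ s ∧ s ≤ 1 / 4 ∧
      ∑ l ∈ Finset.range (2 * m), logMGFBound s (ownShare m k a l) + L ≤
        s * (∑ l ∈ Finset.Ico m (2 * m), ownShare m k a l -
          ∑ l ∈ Finset.range m, ownShare m k a l - m * signedThreshold k a) := by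
  have hM : (100 : ℝ) ≤ m := by exact_mod_cast hm
  have hq : (1 : ℝ) ≤ k := by exact_mod_cast hk
  have hgap := ownShare_gap (m := m) h
  set G := ∑ l ∈ Finset.Ico m (2 * m), ownShare m k a l -
    ∑ l ∈ Finset.range m, ownShare m k a l with hG
  obtain ⟨u, hu⟩ : ∃ u : ℝ, u = 1 / ((k : ℝ) + 1) := ⟨_, rfl⟩
  have hu0 : 0 < u := by rw [hu]; positivity
  have hu1 : u * ((k : ℝ) + 1) = 1 := by rw [hu]; field_simp
  have hu2 : u ≤ 1 / 2 := by nlinarith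
  have hLu : 30 * ((k : ℝ) + 1) * L ≤ m * u ^ 2 := by
    have := mul_le_mul_of_nonneg_right hL (sq_nonneg u)
    calc 30 * ((k : ℝ) + 1) * L = 30 * ((k : ℝ) + 1) * (u * ((k : ℝ) + 1)) ^ 2 * L := by
          rw [hu1]; ring
      _ = 30 * ((k : ℝ) + 1) ^ 3 * L * u ^ 2 := by ring
      _ ≤ _ := this
  have h60 : 60 * L ≤ m * u ^ 2 := by nlinarith
  have hθ : 1 / (5 * ((k : ℝ) + 1)) = u / 5 := by rw [hu]; field_simp
  have hoeff (s : ℝ) : ∑ l ∈ Finset.range (2 * m), logMGFBound s (ownShare m k a l) ≤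
      m * s ^ 2 / 4 := by
    have := sum_logMGFBound_le (2 * m) s (ownShare m k a)
    push_cast at this
    linarith
  by_cases ha : a = 0
  · subst ha
    obtain rfl : b = k := by omega
    refine ⟨4 / 15 * u, by positivity, by linarith, ?_⟩
    rw [signedThreshold, if_pos rfl, hθ]
    have h1 : 33 / 100 * u ≤
        (1 + 2 * m * b) * m / ((2 * m * b + m + 1) * (2 * m * b + 2 * m + 1)) := by
      rw [hu, mul_one_div, div_le_div_iff₀ (by positivity) (by positivity)]
      have e1 : (0 : ℝ) ≤ (m * (b + 1)) * (m - 100) * b := by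
        have : (0 : ℝ) ≤ m - 100 := by linarith
        positivity
      have e2 : (0 : ℝ) ≤ (m ^ 2 * (b + 1)) * (b - 1) := by
        have : (0 : ℝ) ≤ b - 1 := by linarith
        positivity
      have e3 : (0 : ℝ) ≤ m * (b * (b - 1)) := by
        have : (0 : ℝ) ≤ b - 1 := by linarith
        positivity
      nlinarith
    have h2 := mul_le_mul_of_nonneg_left h1 (by positivity : (0 : ℝ) ≤ m)
    have h3 : 4 / 15 * u * (m * (13 / 100 * u)) ≤ 4 / 15 * u * (G - m * (u / 5)) :=
      mul_le_mul_of_nonneg_left (by linarith) (by positivity)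
    have h4 := hoeff (4 / 15 * u)
    nlinarith
  by_cases hak : a = k
  · obtain rfl : b = 0 := by omega
    refine ⟨2 / 5 * u, by positivity, by linarith, ?_⟩
    rw [signedThreshold, if_neg ha, if_pos hak, hθ]
    have h2 : 0 ≤ G := le_trans (by positivity) hgap
    have h3 : 2 / 5 * u * (m * (u / 5)) ≤ 2 / 5 * u * (G - m * (-(u / 5))) :=
      mul_le_mul_of_nonneg_left (by linarith) (by positivity)
    have h4 := hoeff (2 / 5 * u)
    nlinarith
  · refine ⟨1 / 5 * u, by positivity, by linarith, ?_⟩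
    rw [signedThreshold, if_neg ha, if_neg hak]
    have hb : (1 : ℝ) ≤ b := by exact_mod_cast (by omega : 1 ≤ b)
    have hV : ∑ l ∈ Finset.range (2 * m), logMGFBound (1 / 5 * u) (ownShare m k a l) ≤
        (m * b * u ^ 2) * (4824 / 100000 / k) := by
      have := Finset.sum_le_card_nsmul (Finset.range (2 * m))
        (fun l => logMGFBound (1 / 5 * u) (ownShare m k a l))
        (3 / 5 * (1 / 5 * u) ^ 2 * (1005 / 1000 * (b / k))) fun l _ => ?_
      · rw [Finset.card_range, nsmul_eq_mul] at this
        push_cast at this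
        refine this.trans (le_of_eq ?_)
        ring
      refine (min_le_right _ _).trans ?_
      refine mul_le_mul_of_nonneg_left ?_ (by positivity)
      have e0 := ownShare_nonneg m k a l
      have e1 := one_sub_ownShare (m := m) h l
      have e2 : 0 ≤ 1 - ownShare m k a l := by rw [e1]; positivity
      refine (mul_le_of_le_one_left e2 (by linarith)).trans ?_
      rw [e1, mul_div_assoc', div_le_div_iff₀ (by positivity) (by positivity)]
      have e3 : (0 : ℝ) ≤ l := Nat.cast_nonneg l
      have e4 : (100 : ℝ) ≤ m * b := by nlinarith
      have e5 : (0 : ℝ) ≤ b * (2 + l) := by positivity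
      nlinarith
    have hg : m * b * (99 / 100 / (2 * k + 1) * u) ≤ G := by
      refine le_trans ?_ hgap
      rw [mul_assoc]
      refine mul_le_mul_of_nonneg_left ?_ (by positivity)
      rw [hu, div_mul_div_comm, mul_div_assoc', div_le_div_iff₀ (by positivity) (by positivity)]
      have e1 : (2 * m * k + m + 1 : ℝ) ≤ 1004 / 1000 * (m * (2 * k + 1)) := by nlinarith
      have e2 : (2 * m * k + 2 * m + 1 : ℝ) ≤ 1004 / 1000 * (2 * m * (k + 1)) := by nlinarith
      have e3 := mul_le_mul e1 e2 (by positivity) (by positivity)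
      have e4 := mul_le_mul_of_nonneg_left e3 (by positivity : (0 : ℝ) ≤ 99 / 100 * b)
      have e5 : (0 : ℝ) ≤ b * (m * (2 * k + 1) * (2 * m * (k + 1))) := by positivity
      have e6 : (0 : ℝ) ≤ m * ((2 * k + 1) * (k + 1)) := by positivity
      nlinarith
    have hgs := mul_le_mul_of_nonneg_left hg (by positivity : 0 ≤ 1 / 5 * u)
    have hLb : 30 * ((k : ℝ) + 1) * L ≤ m * b * u ^ 2 := by nlinarith [sq_nonneg u]
    have hfin : 1 ≤ 30 * ((k : ℝ) + 1) * (198 / 1000 / (2 * k + 1) - 4824 / 100000 / k) := by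
      rw [div_sub_div _ _ (by positivity) (by positivity), mul_div_assoc',
        le_div_iff₀ (by positivity)]
      nlinarith
    have hpos : 0 ≤ 198 / 1000 / (2 * k + 1) - 4824 / 100000 / (k : ℝ) := by
      rw [div_sub_div _ _ (by positivity) (by positivity)]
      exact div_nonneg (by linarith) (by positivity)
    have h5 := mul_le_mul_of_nonneg_right hLb hpos
    have h6 := mul_le_mul_of_nonneg_left hfin hL0
    have h7 : 1 / 5 * u * (m * b * (99 / 100 / (2 * k + 1) * u)) =
        m * b * u ^ 2 * (198 / 1000 / (2 * k + 1)) := by ring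
    rw [mul_zero, sub_zero]
    generalize (198 : ℝ) / 1000 / (2 * k + 1) = A at *
    generalize (4824 : ℝ) / 100000 / k = C at *
    linarith

/-- The number of the first `q * k + l` times that lie in a round `j`, of length `q`, with `P j`. -/
lemma sum_range_ite_div (P : ℕ → Prop) [DecidablePred P] {q : ℕ} (k l : ℕ) (hl : l ≤ q) :
    ∑ j ∈ Finset.range (q * k + l), (if P (j / q) then (1 : ℝ) else 0) =
      q * ((Finset.range k).filter P).card + l * (if P k then 1 else 0) := by
  have h (k l : ℕ) (hl : l ≤ q) : ∑ j ∈ Finset.range l,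
      (if P ((q * k + j) / q) then (1 : ℝ) else 0) = l * (if P k then 1 else 0) := by
    rw [Finset.sum_congr rfl (g := fun _ => if P k then (1 : ℝ) else 0)]
    · simp
    · intro j hj
      have hj := Finset.mem_range.1 hj
      rw [Nat.mul_add_div (by omega), Nat.div_eq_of_lt (by omega), add_zero]
  rw [Finset.sum_range_add, h k l hl]
  congr 1
  induction k with
  | zero => simp
  | succ k ih =>
    rw [mul_add, mul_one, Finset.sum_range_add, h k q le_rfl, ih, Finset.range_add_one,
      Finset.filter_insert]
    split_ifs
    · rw [Finset.card_insert_of_notMem (by simp)]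
      push_cast
      ring
    · simp

namespace Bandit

variable {K : ℕ} (B : Bandit K)

/-- The arm with number `k` belongs to the trust set. -/
def Trusted (k : ℕ) : Prop := k ∈ B.trustSet.map Fin.valEmbedding

instance : DecidablePred B.Trusted := fun _ => inferInstanceAs (Decidable (_ ∈ _))

lemma trusted_val (a : Fin K) : B.Trusted a ↔ a ∈ B.trustSet := by
  simp only [Trusted, Finset.mem_map, Fin.valEmbedding_apply]
  exact ⟨fun ⟨b, hb, h⟩ => Fin.ext h ▸ hb, fun h => ⟨a, h, rfl⟩⟩

/-- The trusted ones among the first `k` arms. -/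
def trustedBelow (k : ℕ) : Finset ℕ := (Finset.range k).filter B.Trusted

lemma card_trustedBelow_le (k : ℕ) : (B.trustedBelow k).card ≤ k :=
  (Finset.card_filter_le _ _).trans (Finset.card_range k).le

lemma alpha_add_beta {n : ℕ} (x : History K n) : B.alpha x + B.beta x = 2 + n := by
  have h : ∑ i, ((if (x i).recommended ∈ B.trustSet then (1 : ℝ) else 0) +
      (if (x i).recommended ∉ B.trustSet then (1 : ℝ) else 0)) = n := by
    rw [Finset.sum_congr rfl (g := fun _ => (1 : ℝ)) fun i _ => by split_ifs <;> simp]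
    simp
  rw [Finset.sum_add_distrib] at h
  unfold alpha beta
  linarith

/-- The number of arms of the class of the arm `k` among the first `k` ones. -/
def ownCount (k : ℕ) : ℕ :=
  if B.Trusted k then (B.trustedBelow k).card else k - (B.trustedBelow k).card

lemma ownCount_le (k : ℕ) : B.ownCount k ≤ k := by
  have := B.card_trustedBelow_le k
  unfold ownCount
  split_ifs <;> omega

/-- In the first stage the recommendations are deterministic, and so are the trust levels. -/
lemma trust_take_stageOne {H n k l : ℕ} (x : History K n)
    (hx : ∀ i : Fin n, (i : ℕ) < stageOne K H →
      ((x i).recommended : ℕ) = i / (2 * halfRound K H))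
    (hk : k < K) (hl : l < 2 * halfRound K H) (hn : 2 * halfRound K H * k + l ≤ n) :
    B.trust (x.take (2 * halfRound K H * k + l) hn) =
      if B.Trusted k then ownShare (halfRound K H) k (B.ownCount k) l
      else 1 - ownShare (halfRound K H) k (B.ownCount k) l := by
  have hα : B.alpha (x.take (2 * halfRound K H * k + l) hn) =
      1 + 2 * halfRound K H * (B.trustedBelow k).card + l * (if B.Trusted k then 1 else 0) := by
    have h := sum_range_ite_div B.Trusted (q := 2 * halfRound K H) k l hl.le
    rw [alpha, add_assoc, trustedBelow]
    push_cast at h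
    rw [← h, ← Fin.sum_univ_eq_sum_range
      fun j => if B.Trusted (j / (2 * halfRound K H)) then (1 : ℝ) else 0]
    congr 1
    refine Finset.sum_congr rfl fun j _ => ?_
    have hj : (j : ℕ) < stageOne K H := by
      have h1 : 2 * halfRound K H * (k + 1) ≤ 2 * halfRound K H * K :=
        Nat.mul_le_mul_left _ hk
      have h2 := j.is_lt
      rw [mul_add, mul_one] at h1
      unfold stageOne
      omega
    have h3 := hx (Fin.castLE hn j) hj
    simp only [Fin.val_castLE] at h3
    simp only [History.take, ← h3, trusted_val]
    congr
  have hc := B.card_trustedBelow_le k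
  rw [trust, alpha_add_beta, hα]
  unfold ownCount
  split_ifs with hP
  · unfold ownShare
    push_cast
    ring_nf
  · rw [one_sub_ownShare (Nat.sub_add_cancel hc)]
    push_cast
    ring_nf

end Bandit

/-! ### Correctness of the estimated trust set -/

lemma lt_log_of_two_le {H : ℕ} (hH : 2 ≤ H) : 69 / 100 < Real.log H := by
  have h1 : Real.log 2 ≤ Real.log H := Real.log_le_log (by norm_num) (by exact_mod_cast hH)
  have := Real.log_two_gt_d9
  linarith

lemma hundred_le_halfRound {K H : ℕ} (hK : 2 ≤ K) (hH : 2 ≤ H) : 100 ≤ halfRound K H := by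
  have h : (100 : ℝ) ≤ halfRound K H := by
    refine le_trans ?_ (Nat.le_ceil _)
    have h1 := lt_log_of_two_le hH
    have h3 : (2 : ℝ) ^ 3 ≤ (K : ℝ) ^ 3 := pow_le_pow_left₀ (by norm_num) (by exact_mod_cast hK) 3
    nlinarith
  exact_mod_cast h

lemma signedThreshold_sub {k a : ℕ} (hk : 1 ≤ k) (ha : a ≤ k) :
    signedThreshold k (k - a) = -signedThreshold k a := by
  unfold signedThreshold
  split_ifs <;> first | omega | simp

lemma sum_range_two_mul (m : ℕ) (f : ℕ → ℝ) :
    ∑ l ∈ Finset.range (2 * m), f l =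
      ∑ l ∈ Finset.range m, f l + ∑ l ∈ Finset.Ico m (2 * m), f l := by
  rw [Finset.range_eq_Ico, Finset.range_eq_Ico,
    Finset.sum_Ico_consecutive _ (Nat.zero_le m) (by omega)]

/-- The frequencies in a wrong test, in terms of the indicators `Y` of trust moving towards
the class of the arm. -/
lemma sum_le_of_not_accept_iff {n m k : ℕ} (hm : 0 < m) (c : Fin n → Bool) (T : Finset ℕ)
    (hT : T.card ≤ k) (P : Prop) [Decidable P] (h : ¬ (Accept m c k T ↔ P)) {Y : ℕ → ℝ}
    (hY : ∀ l, Y l = if P then chi c (2 * m * k + l) else 1 - chi c (2 * m * k + l)) :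
    if k = 0 then ∑ l ∈ Finset.range (2 * m), Y l ≤ 3 / 2 * m
    else ∑ l ∈ Finset.Ico m (2 * m), Y l - ∑ l ∈ Finset.range m, Y l ≤
      m * signedThreshold k (if P then T.card else k - T.card) := by
  have hM : (0 : ℝ) < m := by exact_mod_cast hm
  have e1 : ∑ l ∈ Finset.range m, chi c (2 * m * k + l) = m * freqOne m c k := by
    unfold freqOne; field_simp
  have e2 : ∑ l ∈ Finset.Ico m (2 * m), chi c (2 * m * k + l) = m * freqTwo m c k := by
    unfold freqTwo; field_simp
  have hth : threshold k T = signedThreshold k T.card := rfl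
  by_cases hP : P
  · have hA : ¬ Accept m c k T := fun hA => h ⟨fun _ => hP, fun _ => hA⟩
    have hYX : Y = fun l => chi c (2 * m * k + l) := funext fun l => by rw [hY, if_pos hP]
    rw [hYX, sum_range_two_mul, e1, e2, if_pos hP]
    unfold Accept at hA
    split_ifs at hA ⊢ with hk
    · subst hk
      nlinarith [not_le.1 hA]
    · rw [hth] at hA
      nlinarith [not_le.1 hA]
  · have hA : Accept m c k T := by
      by_contra hA
      exact h ⟨fun hA' => absurd hA' hA, fun hP' => absurd hP' hP⟩
    have hYX : Y = fun l => 1 - chi c (2 * m * k + l) := funext fun l => by rw [hY, if_neg hP]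
    rw [hYX, sum_range_two_mul, Finset.sum_sub_distrib, Finset.sum_sub_distrib, e1, e2, if_neg hP]
    simp only [Finset.sum_const, Finset.card_range, Nat.card_Ico, nsmul_eq_mul, mul_one,
      (by omega : 2 * m - m = m)]
    unfold Accept at hA
    split_ifs at hA ⊢ with hk
    · subst hk
      nlinarith
    · rw [signedThreshold_sub (by omega) hT]
      rw [hth] at hA
      nlinarith

lemma estimate_eq_trustedBelow {K n m : ℕ} (B : Bandit K) (c : Fin n → Bool) {k : ℕ}
    (h : ∀ j < k, (Accept m c j (B.trustedBelow j) ↔ B.Trusted j)) :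
    estimate m c k = B.trustedBelow k := by
  induction k with
  | zero => rfl
  | succ k ih =>
    have hk : B.trustedBelow (k + 1) =
        if B.Trusted k then insert k (B.trustedBelow k) else B.trustedBelow k := by
      rw [Bandit.trustedBelow, Finset.range_add_one, Finset.filter_insert, ← Bandit.trustedBelow]
    rw [estimate, ih fun j hj => h j (hj.trans k.lt_succ_self), hk]
    simp only [h k k.lt_succ_self]

lemma estTrustSet_eq {K H n : ℕ} (B : Bandit K) (c : Fin n → Bool)
    (h : ∀ k < K, (Accept (halfRound K H) c k (B.trustedBelow k) ↔ B.Trusted k)) :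
    estTrustSet K H c = B.trustSet := by
  ext a
  rw [estTrustSet, estimate_eq_trustedBelow B c h, Finset.mem_filter, Bandit.trustedBelow,
    Finset.mem_filter, Bandit.trusted_val]
  simp

namespace Bandit

variable {K : ℕ} (B : Bandit K)

/-- A wrong test forces a weighted sum of the centred indicators `χ` to be large. -/
lemma exists_weight {H k : ℕ} (hK : 2 ≤ K) (hH : 2 ≤ H) (hk : k < K) :
    ∃ w : ℕ → ℝ, (∀ i, |w i| ≤ 1 / 4) ∧ ∀ n, stageOne K H ≤ n → ∀ x : History K n,
      (∀ i : Fin n, (i : ℕ) < stageOne K H →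
        ((x i).recommended : ℕ) = i / (2 * halfRound K H)) →
      ¬ (Accept (halfRound K H) (fun i => (x i).2.1) k (B.trustedBelow k) ↔ B.Trusted k) →
      Real.log H ≤ ∑ i : Fin n, (w i * ((if (x i).2.1 = true then 1 else 0) -
        B.trust (x.take i i.is_lt.le)) - logMGFBound (w i) (B.trust (x.take i i.is_lt.le))) := by
  have hm := hundred_le_halfRound hK hH
  have hmK : 30 * (K : ℝ) ^ 3 * Real.log H ≤ halfRound K H := Nat.le_ceil _
  set m := halfRound K H with hm_def
  set L := Real.log H with hL_def
  have hL0 : 0 ≤ L := Real.log_natCast_nonneg H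
  have hmk : 30 * ((k : ℝ) + 1) ^ 3 * L ≤ m := by
    refine le_trans ?_ hmK
    have : (k : ℝ) + 1 ≤ K := by exact_mod_cast hk
    gcongr
  obtain ⟨s, hs0, hs1, hs⟩ : ∃ s : ℝ, 0 ≤ s ∧ s ≤ 1 / 4 ∧
      ∑ l ∈ Finset.range (2 * m), logMGFBound s (ownShare m k (B.ownCount k) l) + L ≤
        s * (if k = 0 then ∑ l ∈ Finset.range (2 * m), ownShare m k (B.ownCount k) l - 3 / 2 * m
          else ∑ l ∈ Finset.Ico m (2 * m), ownShare m k (B.ownCount k) l -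
            ∑ l ∈ Finset.range m, ownShare m k (B.ownCount k) l -
            m * signedThreshold k (B.ownCount k)) := by
    by_cases h0 : k = 0
    · subst h0
      have h1 : B.ownCount 0 = 0 := Nat.le_zero.1 (B.ownCount_le 0)
      rw [h1]
      simp only [if_true]
      refine exists_exponent_zero hm ?_
      have h3 : (2 : ℝ) ^ 3 ≤ (K : ℝ) ^ 3 :=
        pow_le_pow_left₀ (by norm_num) (by exact_mod_cast hK) 3
      nlinarith
    · simp only [h0, if_false]
      exact exists_exponent (Nat.add_sub_of_le (B.ownCount_le k)) (by omega) hm hL0 hmk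
  obtain ⟨ε, hε⟩ : ∃ ε : ℝ, ε = if B.Trusted k then 1 else -1 := ⟨_, rfl⟩
  have hεs : |s * ε| ≤ 1 / 4 := by
    rw [hε]
    split_ifs <;> simpa [abs_of_nonneg hs0] using hs1
  -- The sign of the weight of the `l`-th step of the round.
  obtain ⟨σ, hσ⟩ : ∃ σ : ℕ → ℝ, σ = fun l => if k ≠ 0 ∧ l < m then 1 else -1 := ⟨_, rfl⟩
  have hσV (l : ℕ) (p : ℝ) : logMGFBound (s * ε * σ l) p = logMGFBound s p := by
    rw [hε, hσ]
    simp only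
    split_ifs <;> simp [logMGFBound_neg]
  refine ⟨fun i => if 2 * m * k ≤ i ∧ i < 2 * m * k + 2 * m then s * ε * σ (i - 2 * m * k) else 0,
    fun i => ?_, fun n hn x hx hw => ?_⟩
  · simp only
    split_ifs
    · rw [hσ]
      simp only
      split_ifs <;> simpa using hεs
    · norm_num
  set c : Fin n → Bool := fun i => (x i).2.1 with hc
  have hround : 2 * m * k + 2 * m ≤ n := by
    have h1 : 2 * m * (k + 1) ≤ 2 * m * K := Nat.mul_le_mul_left _ hk
    rw [mul_add, mul_one] at h1
    exact h1.trans hn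
  let τ : ℕ → ℝ := fun i => if h : i ≤ n then B.trust (x.take i h) else 0
  let f : ℕ → ℝ := fun i => if 2 * m * k ≤ i ∧ i < 2 * m * k + 2 * m then
    s * ε * σ (i - 2 * m * k) * (chi c i - τ i) - logMGFBound s (τ i) else 0
  have h1 : ∀ i : Fin n, (fun i : Fin n =>
      ((if 2 * m * k ≤ (i : ℕ) ∧ (i : ℕ) < 2 * m * k + 2 * m then
        s * ε * σ (i - 2 * m * k) else 0) * ((if (x i).2.1 = true then 1 else 0) -
        B.trust (x.take i i.is_lt.le)) - logMGFBound (if 2 * m * k ≤ (i : ℕ) ∧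
        (i : ℕ) < 2 * m * k + 2 * m then s * ε * σ (i - 2 * m * k) else 0)
        (B.trust (x.take i i.is_lt.le)))) i = f i := by
    intro i
    simp only [f, τ, i.is_lt.le, chi, i.is_lt, dif_pos, hc]
    split_ifs <;> simp only [hσV, logMGFBound_zero, zero_mul, sub_zero]
  rw [Finset.sum_congr rfl fun i _ => h1 i, Fin.sum_univ_eq_sum_range f]
  have h2 : ∑ i ∈ Finset.range n, f i = ∑ l ∈ Finset.range (2 * m), f (2 * m * k + l) := by
    rw [← Finset.sum_subset (s₁ := Finset.Ico (2 * m * k) (2 * m * k + 2 * m)),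
      Finset.sum_Ico_eq_sum_range, Nat.add_sub_cancel_left]
    · intro i hi
      have := Finset.mem_Ico.1 hi
      exact Finset.mem_range.2 (by omega)
    · intro i _ hi
      simp only [f]
      rw [if_neg (by simpa using hi)]
  let Y : ℕ → ℝ := fun l =>
    if B.Trusted k then chi c (2 * m * k + l) else 1 - chi c (2 * m * k + l)
  have h3 : ∀ l ∈ Finset.range (2 * m), f (2 * m * k + l) =
      s * (σ l * Y l - σ l * ownShare m k (B.ownCount k) l) -
        logMGFBound s (ownShare m k (B.ownCount k) l) := by
    intro l hl
    have hl := Finset.mem_range.1 hl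
    have hle : 2 * m * k + l ≤ n := by omega
    simp only [f, τ, Y]
    rw [if_pos ⟨by omega, by omega⟩, dif_pos hle, B.trust_take_stageOne x hx hk hl hle,
      Nat.add_sub_cancel_left, hε]
    split_ifs
    · ring
    · rw [logMGFBound_one_sub]
      ring
  have h4 := sum_le_of_not_accept_iff (by omega) c (B.trustedBelow k) (B.card_trustedBelow_le k)
    (B.Trusted k) hw (Y := Y) fun _ => rfl
  rw [h2, Finset.sum_congr rfl h3, Finset.sum_sub_distrib, ← Finset.mul_sum,
    Finset.sum_sub_distrib]
  have h5 (g : ℕ → ℝ) : ∑ l ∈ Finset.range (2 * m), σ l * g l =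
      if k = 0 then -∑ l ∈ Finset.range (2 * m), g l
      else ∑ l ∈ Finset.range m, g l - ∑ l ∈ Finset.Ico m (2 * m), g l := by
    rw [hσ]
    by_cases h0 : k = 0
    · simp [h0]
    · rw [sum_range_two_mul, if_neg h0, sub_eq_add_neg, ← Finset.sum_neg_distrib]
      congr 1
      · refine Finset.sum_congr rfl fun l hl => ?_
        simp [h0, Finset.mem_range.1 hl]
      · refine Finset.sum_congr rfl fun l hl => ?_
        simp [h0, (Finset.mem_Ico.1 hl).1]
  rw [h5, h5]
  rw [← ownCount] at h4
  have h6 : ∀ u v : ℝ, u ≤ v → s * u ≤ s * v := fun u v h => mul_le_mul_of_nonneg_left h hs0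
  split_ifs at hs h4 ⊢
  all_goals
    refine le_sub_iff_add_le.2 ((add_comm _ _).trans_le (hs.trans (h6 _ _ ?_)))
    linarith [h4]

lemma ae_recommended_candidates {H : ℕ} (hK : 2 ≤ K) (n : ℕ) :
    ∀ᵐ x ∂B.law (trustAwareUCB K H hK) n, ∀ i : Fin n,
      (x i).recommended ∈ candidates K H i (x.take i i.is_lt.le).obs := by
  refine B.ae_recommended _ (P := fun n o a => a ∈ candidates K H n o) (fun n a => ?_)
    (fun n o => ?_) n
  · exact @measurable_candidates K H n {S | a ∈ S} trivial
  · change ∀ᵐ a ∂uniformOn (candidates K H n o : Set (Fin K)), a ∈ candidates K H n o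
    have h := ae_cond_mem (μ := Measure.count)
      (s := (candidates K H n o : Set (Fin K))) .of_discrete
    exact h

lemma recommended_stageOne {H n : ℕ} {x : History K n}
    (hx : ∀ i : Fin n, (x i).recommended ∈ candidates K H i (x.take i i.is_lt.le).obs)
    (i : Fin n) (hi : (i : ℕ) < stageOne K H) :
    ((x i).recommended : ℕ) = i / (2 * halfRound K H) := by
  have h := hx i
  rw [candidates, if_pos hi] at h
  exact (Finset.mem_filter.1 h).2

/-- The first stage identifies the trust set with high probability. -/
lemma law_estTrustSet_ne {H : ℕ} (hK : 2 ≤ K) (hH : 2 ≤ H) {n : ℕ} (hn : stageOne K H ≤ n) :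
    B.law (trustAwareUCB K H hK) n
      {x | estTrustSet K H (fun i => (x i).2.1) ≠ B.trustSet} ≤
        K * ENNReal.ofReal (Real.exp (-Real.log H)) := by
  -- A union bound over the tests of the arms.
  choose w hw1 hw2 using fun k : Fin K => B.exists_weight hK hH k.is_lt
  calc _ ≤ B.law (trustAwareUCB K H hK) n (⋃ k : Fin K, {x | Real.log H ≤ ∑ i : Fin n,
        (w k i * ((if (x i).2.1 = true then 1 else 0) - B.trust (x.take i i.is_lt.le)) -
          logMGFBound (w k i) (B.trust (x.take i i.is_lt.le)))}) := ?_
    _ ≤ ∑ k : Fin K, ENNReal.ofReal (Real.exp (-Real.log H)) :=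
        (measure_iUnion_fintype_le _ _).trans
          (Finset.sum_le_sum fun k _ => B.law_follow_le _ n (w k) (hw1 k) _)
    _ = _ := by simp
  refine measure_mono_ae ?_
  filter_upwards [B.ae_recommended_candidates hK n] with x hx hne
  by_contra hc
  refine hne (estTrustSet_eq B _ fun k hk => ?_)
  by_contra hk'
  exact hc (Set.mem_iUnion.2 ⟨⟨k, hk⟩, hw2 ⟨k, hk⟩ n hn x (recommended_stageOne hx) hk'⟩)

end Bandit

namespace Bandit

variable {K : ℕ} (B : Bandit K)

lemma mean_mem_Icc (a : Fin K) : B.mean a ∈ Set.Icc (0 : ℝ) 1 := by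
  have h : Integrable (fun R : Fin K → ℝ => R a) B.rewardLaw := by
    refine Integrable.of_bound (measurable_pi_apply a).aestronglyMeasurable 1 ?_
    filter_upwards [B.reward_mem] with R hR
    rw [Real.norm_eq_abs, abs_le]
    exact ⟨by linarith [(hR a).1], (hR a).2⟩
  constructor
  · refine integral_nonneg_of_ae ?_
    filter_upwards [B.reward_mem] with R hR using (hR a).1
  · have h1 : ∫ R, R a ∂B.rewardLaw ≤ ∫ _, (1 : ℝ) ∂B.rewardLaw := by
      refine integral_mono_ae h (integrable_const _) ?_
      filter_upwards [B.reward_mem] with R hR using (hR a).2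
    simpa [mean] using h1

/-! ### Concentration of the empirical means -/

/-- The number of pulls of the arm `a` in the second stage. Unlike `pulls` it may be zero. -/
def count (H : ℕ) {n : ℕ} (x : History K n) (a : Fin K) : ℝ :=
  ∑ i : Fin n, if stageOne K H ≤ (i : ℕ) ∧ (x i).pulled = a then 1 else 0

/-- The sum of the centred rewards that the arm `a` has given in the second stage. -/
def deviation (H : ℕ) {n : ℕ} (x : History K n) (a : Fin K) : ℝ :=
  ∑ i : Fin n, if stageOne K H ≤ (i : ℕ) ∧ (x i).pulled = a then (x i).2.2 a - B.mean a else 0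

lemma count_eq_natCast (H : ℕ) {n : ℕ} (x : History K n) (a : Fin K) :
    ∃ j ≤ n, count H x a = j := by
  refine ⟨(Finset.univ.filter fun i : Fin n =>
    stageOne K H ≤ (i : ℕ) ∧ (x i).pulled = a).card, ?_, ?_⟩
  · exact (Finset.card_filter_le _ _).trans (by simp)
  · simp [count]

/-- The deviation after a random number of pulls is controlled for each value `j` of that number
separately, with the exponent that is optimal for it. The sign `σ` selects the upper or the lower
tail. -/
lemma law_deviation_le (π : Policy K) (H n j : ℕ) (hj : 1 ≤ j) (a : Fin K) {σ : ℝ}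
    (hσ : σ ^ 2 = 1) :
    B.law π n {x | count H x a = j ∧ 2 * Real.sqrt (j * Real.log H) ≤ σ * B.deviation H x a} ≤
      ENNReal.ofReal (Real.exp (-(8 * Real.log H))) := by
  have hL : 0 ≤ Real.log H := Real.log_natCast_nonneg H
  have hj0 : (0 : ℝ) < j := by exact_mod_cast hj
  set L := Real.log H with hL_def
  obtain ⟨s, hs⟩ : ∃ s : ℝ, s = 8 * Real.sqrt (L / j) := ⟨_, rfl⟩
  have hs0 : 0 ≤ s := by rw [hs]; positivity
  have hs2 : s ^ 2 * j = 64 * L := by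
    rw [hs, mul_pow, Real.sq_sqrt (by positivity)]
    field_simp
    ring
  have hsL : s * Real.sqrt (j * L) = 8 * L := by
    rw [hs, mul_assoc, ← Real.sqrt_mul (by positivity), (by field_simp : L / j * (j * L) = L ^ 2),
      Real.sqrt_sq hL]
  let Z : (i : ℕ) → History K i → Step K → ℝ := fun i _ y =>
    if stageOne K H ≤ i ∧ y.pulled = a then s * σ * (y.2.2 a - B.mean a) - (s * σ) ^ 2 / 8 else 0
  have hZm (i : ℕ) : Measurable fun y : Step K =>
      if stageOne K H ≤ i ∧ y.pulled = a then
        s * σ * (y.2.2 a - B.mean a) - (s * σ) ^ 2 / 8 else 0 := by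
    refine Measurable.ite ?_ (by fun_prop) measurable_const
    exact (MeasurableSet.const _).inter (measurableSet_eq_fun measurable_pulled measurable_const)
  refine le_trans (measure_mono fun x hx => ?_) (B.law_le_exp_neg π (Z := Z)
    (fun i => (hZm i).comp measurable_snd) (fun i x => ?_) n (8 * L))
  · have h1 : ∑ i : Fin n, Z i (x.take i i.is_lt.le) (x i) =
        s * σ * B.deviation H x a - (s * σ) ^ 2 / 8 * count H x a := by
      rw [deviation, count, Finset.mul_sum, Finset.mul_sum, ← Finset.sum_sub_distrib]
      refine Finset.sum_congr rfl fun i _ => ?_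
      simp only [Z]
      split_ifs <;> simp
    obtain ⟨hx1, hx2⟩ := hx
    have h2 := mul_le_mul_of_nonneg_left hx2 hs0
    change 8 * L ≤ ∑ i : Fin n, Z i (x.take i i.is_lt.le) (x i)
    rw [h1, hx1, mul_pow, hσ]
    linarith
  · refine B.lintegral_step_le_one_of_reward π i x
      (f := fun y => ENNReal.ofReal (Real.exp (Z i x y)))
      ((Real.measurable_exp.comp (hZm i)).ennreal_ofReal) fun p c => ?_
    have hp (R : Fin K → ℝ) : Step.pulled (p, (c, R)) = if c = true then p.1 else p.2 := rfl
    simp only [Z, hp]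
    split_ifs
    all_goals first
      | exact lintegral_exp_sub_mean_le_one (X := fun R : Fin K → ℝ => R a)
          (measurable_pi_apply a).aemeasurable (B.reward_mem.mono fun R hR => hR a) (s * σ)
      | simp

/-- The centred rewards of some arm are larger, in absolute value, than the confidence bounds of the
algorithm allow for. -/
def Deviates (H : ℕ) {n : ℕ} (x : History K n) : Prop :=
  ∃ a, ∃ j : ℕ, 1 ≤ j ∧ j ≤ n ∧ count H x a = j ∧
    2 * Real.sqrt (j * Real.log H) ≤ |B.deviation H x a|

lemma law_deviates_le (π : Policy K) (H n : ℕ) :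
    B.law π n {x | B.Deviates H x} ≤
      2 * K * n * ENNReal.ofReal (Real.exp (-(8 * Real.log H))) := by
  let E : Fin K → Fin n → Fin 2 → Set (History K n) := fun a j σ =>
    {x | count H x a = ((j + 1 : ℕ) : ℝ) ∧ 2 * Real.sqrt ((j + 1 : ℕ) * Real.log H) ≤
      (if σ = 0 then 1 else -1) * B.deviation H x a}
  have hE (a : Fin K) (j : Fin n) (σ : Fin 2) : B.law π n (E a j σ) ≤
      ENNReal.ofReal (Real.exp (-(8 * Real.log H))) :=
    B.law_deviation_le π H n (j + 1) (by omega) a (by split_ifs <;> norm_num)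
  calc B.law π n {x | B.Deviates H x} ≤ B.law π n (⋃ a, ⋃ j, ⋃ σ, E a j σ) :=
        measure_mono fun x hx => ?_
    _ ≤ ∑ a, ∑ j, ∑ σ, B.law π n (E a j σ) := by
        refine (measure_iUnion_fintype_le _ _).trans (Finset.sum_le_sum fun a _ => ?_)
        refine (measure_iUnion_fintype_le _ _).trans (Finset.sum_le_sum fun j _ => ?_)
        exact measure_iUnion_fintype_le _ _
    _ ≤ ∑ a : Fin K, ∑ j : Fin n, ∑ σ : Fin 2, ENNReal.ofReal (Real.exp (-(8 * Real.log H))) :=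
        Finset.sum_le_sum fun a _ => Finset.sum_le_sum fun j _ => Finset.sum_le_sum fun σ _ =>
          hE a j σ
    _ = _ := by
        simp only [Finset.sum_const, Finset.card_univ, Fintype.card_fin, nsmul_eq_mul]
        push_cast
        ring
  obtain ⟨a, j, hj1, hjn, hc, hd⟩ := hx
  obtain ⟨i, rfl⟩ : ∃ i, j = i + 1 := ⟨j - 1, by omega⟩
  simp only [Set.mem_iUnion]
  rcases le_abs.1 hd with h | h
  · exact ⟨a, ⟨i, by omega⟩, 0, hc, by simpa using h⟩
  · exact ⟨a, ⟨i, by omega⟩, 1, hc, by simpa using h⟩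

lemma pulls_eq (H : ℕ) {n : ℕ} (x : History K n) (a : Fin K) :
    pulls K H x.obs a = max 1 (count H x a) := rfl

/-- The upper confidence bounds are valid, and not too large, unless some arm deviates. -/
lemma ucb_bounds {H : ℕ} (hH : 2 ≤ H) {n : ℕ} {x : History K n}
    (hx : ¬ B.Deviates H x) (a : Fin K) :
    B.mean a ≤ ucb K H x.obs a ∧
      ucb K H x.obs a ≤ B.mean a + 4 * Real.sqrt (Real.log H / pulls K H x.obs a) := by
  have hL := lt_log_of_two_le hH
  set L := Real.log H with hL_def
  obtain ⟨hm0, hm1⟩ := B.mean_mem_Icc a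
  have hsq : 1 / 2 ≤ Real.sqrt L := Real.le_sqrt_of_sq_le (by linarith)
  by_cases hn : n = stageOne K H
  · have hc : count H x a = 0 := Finset.sum_eq_zero fun i _ => if_neg fun h => by
      have := i.is_lt; omega
    rw [ucb, if_pos hn, pulls_eq, hc, max_eq_left zero_le_one, div_one]
    exact ⟨hm1, by linarith⟩
  have hsum : (∑ i : Fin n, if stageOne K H ≤ (i : ℕ) ∧ (x.obs i).1 = a then (x.obs i).2.1 else 0) =
      B.deviation H x a + B.mean a * count H x a := by
    rw [deviation, count, Finset.mul_sum, ← Finset.sum_add_distrib]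
    refine Finset.sum_congr rfl fun i _ => ?_
    change (if stageOne K H ≤ (i : ℕ) ∧ (x i).pulled = a then (x i).2.2 (x i).pulled else 0) = _
    split_ifs with h
    · rw [h.2]; ring
    · ring
  rw [ucb, if_neg hn, hsum, pulls_eq, ← hL_def]
  obtain ⟨j, hjn, hj⟩ := count_eq_natCast H x a
  rcases Nat.eq_zero_or_pos j with h0 | h0
  -- An arm without pulls has the confidence bound `1`, since `2 * √(log H) ≥ 1` for `H ≥ 2`.
  · have hd : B.deviation H x a = 0 := by
      rw [h0, Nat.cast_zero, count, Finset.sum_eq_zero_iff_of_nonneg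
        fun i _ => by split_ifs <;> norm_num] at hj
      refine Finset.sum_eq_zero fun i hi => if_neg fun h => ?_
      have := hj i hi
      rw [if_pos h] at this
      norm_num at this
    rw [hj, hd, h0, Nat.cast_zero, max_eq_left zero_le_one]
    simp only [div_one, mul_zero, add_zero, zero_add]
    rw [min_eq_left (by linarith)]
    exact ⟨hm1, by linarith⟩
  · have hj1 : (1 : ℝ) ≤ j := by exact_mod_cast h0
    have hd : |B.deviation H x a| < 2 * Real.sqrt (j * L) := by
      by_contra hc
      exact hx ⟨a, j, h0, hjn, hj, not_lt.1 hc⟩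
    rw [hj, max_eq_right hj1]
    have e1 : Real.sqrt (j * L) = j * Real.sqrt (L / j) := by
      rw [(by field_simp : j * L = (j : ℝ) ^ 2 * (L / j)), Real.sqrt_mul (sq_nonneg _),
        Real.sqrt_sq (by linarith)]
    have e2 : 1 / (j : ℝ) * (B.deviation H x a + B.mean a * j) =
        B.mean a + B.deviation H x a / j := by
      field_simp
      ring
    have e3 : |B.deviation H x a / j| ≤ 2 * Real.sqrt (L / j) := by
      rw [abs_div, abs_of_pos (by linarith : (0 : ℝ) < j), div_le_iff₀ (by linarith)]
      linarith
    rw [e2]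
    have e4 := abs_le.1 e3
    exact ⟨le_min hm1 (by linarith), (min_le_right _ _).trans (by linarith)⟩

/-! ### The regret of the second stage -/

/-- The increments of `3 * √j` dominate the widths of the confidence intervals, so that their sums
telescope. -/
lemma one_div_sqrt_max_le (j : ℕ) :
    1 / Real.sqrt (max 1 (j : ℝ)) ≤ 3 * (Real.sqrt (j + 1) - Real.sqrt j) := by
  rcases Nat.eq_zero_or_pos j with h | h
  · subst h; norm_num
  · have hj : (1 : ℝ) ≤ j := by exact_mod_cast h
    rw [max_eq_right hj, div_le_iff₀ (Real.sqrt_pos.2 (by linarith))]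
    have h1 := Real.sq_sqrt (by linarith : (0 : ℝ) ≤ j)
    have h2 := Real.sq_sqrt (by linarith : (0 : ℝ) ≤ (j : ℝ) + 1)
    have h3 : Real.sqrt (j + 1) ≤ 2 * Real.sqrt j := by
      rw [Real.sqrt_le_left (by positivity), mul_pow, h1]
      linarith
    have h4 : Real.sqrt j ≤ Real.sqrt (j + 1) := Real.sqrt_le_sqrt (by linarith)
    nlinarith [mul_nonneg (sub_nonneg.2 h4) (sub_nonneg.2 h3)]

/-- The sum of the widths of the confidence intervals of the pulled arms. -/
lemma sum_one_div_sqrt_pulls_le (H : ℕ) {n : ℕ} (x : History K n) :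
    ∑ i : Fin n, (if stageOne K H ≤ (i : ℕ) then
      1 / Real.sqrt (pulls K H (x.take i i.is_lt.le).obs (x i).pulled) else 0) ≤
      3 * ∑ a, Real.sqrt (count H x a) := by
  induction n with
  | zero =>
    simp only [Finset.univ_eq_empty, Finset.sum_empty]
    positivity
  | succ n ih =>
    have hcount (a : Fin K) : count H x a = count H (x.take n n.le_succ) a +
        if stageOne K H ≤ n ∧ (x (Fin.last n)).pulled = a then 1 else 0 := by
      rw [count, Fin.sum_univ_castSucc]
      rfl
    rw [Fin.sum_univ_castSucc]
    refine (add_le_add_left (ih (x.take n n.le_succ)) _).trans ?_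
    change 3 * _ + (if stageOne K H ≤ n then 1 / Real.sqrt (pulls K H
      (x.take n n.le_succ).obs (x (Fin.last n)).pulled) else 0) ≤ _
    by_cases hn : stageOne K H ≤ n
    · rw [if_pos hn]
      set b := (x (Fin.last n)).pulled with hb
      obtain ⟨j, -, hj⟩ := count_eq_natCast H (x.take n n.le_succ) b
      have h1 : ∑ a, Real.sqrt (count H x a) - ∑ a, Real.sqrt (count H (x.take n n.le_succ) a) =
          Real.sqrt (j + 1) - Real.sqrt j := by
        rw [← Finset.sum_sub_distrib, Finset.sum_eq_single b]
        · rw [hcount, hj]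
          simp [hn]
        · intro a _ ha
          rw [hcount, if_neg fun h => ha h.2.symm, add_zero, sub_self]
        · simp
      have h2 := one_div_sqrt_max_le j
      rw [← hj, ← pulls_eq, hj] at h2
      linarith
    · rw [if_neg hn, add_zero]
      refine mul_le_mul_of_nonneg_left (Finset.sum_le_sum fun a _ => ?_) (by norm_num)
      rw [hcount, if_neg fun h => hn h.1, add_zero]

lemma sum_sqrt_count_le (H : ℕ) {n : ℕ} (x : History K n) :
    ∑ a, Real.sqrt (count H x a) ≤ Real.sqrt (K * n) := by
  have h0 (a : Fin K) : 0 ≤ count H x a := by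
    obtain ⟨j, -, hj⟩ := count_eq_natCast H x a
    rw [hj]; positivity
  have h1 : ∑ a, count H x a ≤ n := by
    unfold count
    rw [Finset.sum_comm]
    refine (Finset.sum_le_sum (g := fun _ => (1 : ℝ)) fun i _ => ?_).trans (by simp)
    rw [Finset.sum_eq_single (x i).pulled]
    · split_ifs <;> norm_num
    · intro a _ ha
      exact if_neg fun h => ha h.2.symm
    · simp
  refine Real.le_sqrt_of_sq_le ?_
  have h2 := sq_sum_le_card_mul_sum_sq (s := Finset.univ) (f := fun a => Real.sqrt (count H x a))
  simp_rw [Real.sq_sqrt (h0 _)] at h2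
  rw [Finset.card_univ, Fintype.card_fin] at h2
  exact h2.trans (mul_le_mul_of_nonneg_left h1 (Nat.cast_nonneg K))

end Bandit

/-- The estimate after `k` rounds depends on the indicators `χ` of these rounds only. -/
lemma estimate_take {K n i k : ℕ} (m : ℕ) (x : History K n) (hi : i ≤ n) (hk : 2 * m * k ≤ i) :
    estimate m (fun j => (x.take i hi j).2.1) k = estimate m (fun j => (x j).2.1) k := by
  induction k with
  | zero => rfl
  | succ k ih =>
    rw [mul_add, mul_one] at hk
    have h1 (l : ℕ) (hl : l < 2 * m) : chi (fun j => (x.take i hi j).2.1) (2 * m * k + l) =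
        chi (fun j => (x j).2.1) (2 * m * k + l) := by
      rw [chi, chi, dif_pos (by omega), dif_pos (by omega)]
      rfl
    have h2 : freqOne m (fun j => (x.take i hi j).2.1) k = freqOne m (fun j => (x j).2.1) k := by
      unfold freqOne
      congr 1
      refine Finset.sum_congr rfl fun l hl => h1 l ?_
      have := Finset.mem_range.1 hl
      omega
    have h3 : freqTwo m (fun j => (x.take i hi j).2.1) k = freqTwo m (fun j => (x j).2.1) k := by
      unfold freqTwo
      congr 1
      exact Finset.sum_congr rfl fun l hl => h1 l (Finset.mem_Ico.1 hl).2
    have h4 (T : Finset ℕ) : Accept m (fun j => (x.take i hi j).2.1) k T ↔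
        Accept m (fun j => (x j).2.1) k T := by
      unfold Accept
      split_ifs with h0
      · subst h0; rw [h2, h3]
      · rw [h2, h3]
    simp only [estimate]
    rw [ih (by omega)]
    by_cases hA : Accept m (fun j => (x j).2.1) k (estimate m (fun j => (x j).2.1) k)
    · rw [if_pos hA, if_pos ((h4 _).2 hA)]
    · rw [if_neg hA, if_neg fun h => hA ((h4 _).1 h)]

lemma estTrustSet_take {K H n i : ℕ} (x : History K n) (hi : i ≤ n) (h : stageOne K H ≤ i) :
    estTrustSet K H (fun j => (x.take i hi j).2.1) = estTrustSet K H (fun j => (x j).2.1) := by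
  rw [estTrustSet, estTrustSet, estimate_take _ x hi h]

namespace Bandit

variable {K : ℕ} (B : Bandit K)

lemma mem_maximizers {T : Finset (Fin K)} (hT : T.Nonempty) {u : Fin K → ℝ} {a : Fin K} :
    a ∈ maximizers T u ↔ a ∈ T ∧ ∀ b ∈ T, u b ≤ u a := by
  rw [maximizers, if_neg hT.ne_empty, Finset.mem_filter]

/-- Once the trust set has been identified, only trusted arms are recommended, so that `β` stays
bounded by the length of the first stage. -/
lemma one_sub_trust_le {H n : ℕ} (hT : B.trustSet.Nonempty) {x : History K n}
    (hx : ∀ i : Fin n, (x i).recommended ∈ candidates K H i (x.take i i.is_lt.le).obs)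
    (he : estTrustSet K H (fun i => (x i).2.1) = B.trustSet) :
    1 - B.trust x ≤ (1 + stageOne K H) / (n + 2) := by
  have hβ : B.beta x ≤ 1 + stageOne K H := by
    have h1 (i : Fin n) : (if (x i).recommended ∉ B.trustSet then (1 : ℝ) else 0) ≤
        (fun i : ℕ => if i < stageOne K H then (1 : ℝ) else 0) i := by
      simp only
      by_cases hi : (i : ℕ) < stageOne K H
      · rw [if_pos hi]
        split_ifs <;> norm_num
      · have h := hx i
        have hobs : estTrustSet K H (fun j => ((x.take i i.is_lt.le).obs j).2.2) = B.trustSet :=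
          (estTrustSet_take x i.is_lt.le (not_lt.1 hi)).trans he
        rw [candidates, if_neg hi, hobs, mem_maximizers hT] at h
        rw [if_neg (not_not_intro h.1), if_neg hi]
    have h2 := Finset.sum_le_sum fun i (_ : i ∈ Finset.univ) => h1 i
    rw [Fin.sum_univ_eq_sum_range (fun i : ℕ => if i < stageOne K H then (1 : ℝ) else 0)] at h2
    have h3 : ∑ i ∈ Finset.range n, (if i < stageOne K H then (1 : ℝ) else 0) ≤ stageOne K H := by
      rw [← Finset.sum_filter, Finset.sum_const, nsmul_eq_mul, mul_one]
      have : ((Finset.range n).filter (· < stageOne K H)) ⊆ Finset.range (stageOne K H) :=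
        fun i hi => Finset.mem_range.2 (Finset.mem_filter.1 hi).2
      have := Finset.card_le_card this
      rw [Finset.card_range] at this
      exact_mod_cast this
    unfold beta
    linarith
  have h4 := B.alpha_add_beta x
  have h5 : 1 - B.trust x = B.beta x / (n + 2) := by
    rw [trust, h4, one_sub_div (by positivity)]
    congr 1
    · linarith
    · ring
  rw [h5]
  gcongr

/-- The probability that a recommendation of the second stage is not followed although the trust set
has been identified. -/
lemma law_not_follow_le {H : ℕ} (hK : 2 ≤ K) (hT : B.trustSet.Nonempty) {n N : ℕ} (h : n < N) :
    B.law (trustAwareUCB K H hK) N {x | (x ⟨n, h⟩).2.1 = false ∧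
      estTrustSet K H (fun i => (x.take n h.le i).2.1) = B.trustSet} ≤
      ENNReal.ofReal ((1 + stageOne K H) / (n + 2)) := by
  set G : Set (History K n) := {x | estTrustSet K H (fun i => (x i).2.1) = B.trustSet} with hG
  have hGm : MeasurableSet G := by
    have h1 : Measurable fun x : History K n => fun i => (x i).2.1 := by fun_prop
    exact h1 (.of_discrete : MeasurableSet
      {c : Fin n → Bool | estTrustSet K H c = B.trustSet})
  let f : History K n → Step K → ℝ≥0∞ := fun x s =>
    G.indicator 1 x * (if s.2.1 = false then 1 else 0)
  have hf : Measurable (Function.uncurry f) := by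
    refine Measurable.mul ((measurable_one.indicator hGm).comp measurable_fst) ?_
    exact (Measurable.of_discrete (f := fun c : Bool => if c = false then (1 : ℝ≥0∞) else 0)).comp
      (by fun_prop : Measurable fun q : History K n × Step K => q.2.2.1)
  have h1 := B.lintegral_law_take (trustAwareUCB K H hK) h hf
  have h2 : {x : History K N | (x ⟨n, h⟩).2.1 = false ∧
      estTrustSet K H (fun i => (x.take n h.le i).2.1) = B.trustSet} ⊆
      {x | 1 ≤ f (x.take n h.le) (x ⟨n, h⟩)} := by
    rintro x ⟨hx1, hx2⟩
    have : x.take n h.le ∈ G := hx2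
    simp [f, this, hx1]
  have hfm := History.measurable_take_apply h hf
  refine (measure_mono h2).trans ((meas_ge_le_lintegral_div hfm.aemeasurable one_ne_zero
    ENNReal.one_ne_top).trans ?_)
  rw [div_one, h1]
  have h3 (x : History K n) : ∫⁻ s, f x s ∂B.step (trustAwareUCB K H hK) n x =
      G.indicator 1 x * ENNReal.ofReal (1 - B.trust x) := by
    have hm : Measurable fun s : Step K => if s.2.1 = false then (1 : ℝ≥0∞) else 0 :=
      (Measurable.of_discrete (f := fun c : Bool => if c = false then (1 : ℝ≥0∞) else 0)).comp
        (by fun_prop)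
    simp only [f]
    rw [lintegral_const_mul _ hm,
      B.lintegral_step_follow _ n x (f := fun c => if c = false then 1 else 0)]
    simp
  simp_rw [h3]
  calc _ ≤ ∫⁻ _, ENNReal.ofReal ((1 + stageOne K H) / (n + 2))
          ∂B.law (trustAwareUCB K H hK) n := ?_
    _ = _ := by simp
  refine lintegral_mono_ae ?_
  filter_upwards [B.ae_recommended_candidates hK n] with x hx
  by_cases hxG : x ∈ G
  · simpa [hxG] using ENNReal.ofReal_le_ofReal (B.one_sub_trust_le hT hx hxG)
  · simp [hxG]

end Bandit

namespace Bandit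

variable {K : ℕ} (B : Bandit K)

/-! ### The expected regret -/

lemma best_mem_Icc (hB : B.Consistent) : B.best ∈ Set.Icc (0 : ℝ) 1 := by
  obtain ⟨a, -, ha⟩ := hB
  exact ha ▸ B.mean_mem_Icc a

lemma best_sub_mean_le_one (hB : B.Consistent) (a : Fin K) : B.best - B.mean a ≤ 1 := by
  linarith [(B.best_mem_Icc hB).2, (B.mean_mem_Icc a).1]

lemma regret_le (hB : B.Consistent) {n : ℕ} (x : History K n) : B.regret x ≤ n := by
  refine (Finset.sum_le_sum fun i _ => B.best_sub_mean_le_one hB (x i).pulled).trans ?_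
  simp

/-- The recommendation at time `i + 1` is not followed, although the estimate of the trust set that
is computed from the steps before it is correct. -/
def NotFollowed (H : ℕ) {n : ℕ} (i : Fin n) (x : History K n) : Prop :=
  (x i).2.1 = false ∧ estTrustSet K H (fun j => (x.take i i.is_lt.le j).2.1) = B.trustSet

open Classical in
/-- The regret on the event that the trust set is identified and no arm deviates. -/
lemma regret_le_of_good {H : ℕ} (hH : 2 ≤ H) (hB : B.Consistent) {n : ℕ} {x : History K n}
    (hx : ∀ i : Fin n, (x i).recommended ∈ candidates K H i (x.take i i.is_lt.le).obs)
    (he : estTrustSet K H (fun i => (x i).2.1) = B.trustSet)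
    (hd : ∀ i : Fin n, ¬ B.Deviates H (x.take i i.is_lt.le)) :
    B.regret x ≤ stageOne K H + ∑ i : Fin n, (if B.NotFollowed H i x then 1 else 0) +
      12 * Real.sqrt (K * n * Real.log H) := by
  have hL : 0 ≤ Real.log H := Real.log_natCast_nonneg H
  have hstep (i : Fin n) : B.best - B.mean (x i).pulled ≤
      (fun i : ℕ => if i < stageOne K H then (1 : ℝ) else 0) i +
        (if B.NotFollowed H i x then 1 else 0) +
        4 * Real.sqrt (Real.log H) * (if stageOne K H ≤ (i : ℕ) then
          1 / Real.sqrt (pulls K H (x.take i i.is_lt.le).obs (x i).pulled) else 0) := by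
    have h1 := B.best_sub_mean_le_one hB (x i).pulled
    simp only
    by_cases hi : (i : ℕ) < stageOne K H
    · rw [if_pos hi, if_neg (not_le.2 hi)]
      split_ifs <;> linarith
    rw [if_neg hi, if_pos (not_lt.1 hi)]
    have hobs : estTrustSet K H (fun j => (x.take i i.is_lt.le j).2.1) = B.trustSet :=
      (estTrustSet_take x i.is_lt.le (not_lt.1 hi)).trans he
    by_cases hf : (x i).2.1 = false
    · rw [if_pos ⟨hf, hobs⟩]
      have : 0 ≤ 4 * Real.sqrt (Real.log H) *
          (1 / Real.sqrt (pulls K H (x.take i i.is_lt.le).obs (x i).pulled)) := by positivity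
      linarith
    · rw [if_neg fun h => hf h.1]
      obtain ⟨a, haT, ha⟩ := hB
      have hp : (x i).pulled = (x i).recommended := by
        rw [Step.pulled, if_pos (by simpa using hf)]; rfl
      have hc := hx i
      have hobs' : estTrustSet K H (fun j => ((x.take i i.is_lt.le).obs j).2.2) = B.trustSet :=
        hobs
      rw [candidates, if_neg hi, hobs', mem_maximizers ⟨a, haT⟩, ← hp] at hc
      have h2 := (B.ucb_bounds hH (hd i) a).1
      have h3 := (B.ucb_bounds hH (hd i) (x i).pulled).2
      have h4 := hc.2 a haT
      rw [Real.sqrt_div hL] at h3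
      rw [← ha, mul_assoc, mul_one_div]
      linarith
  have h1 := Finset.sum_le_sum fun i (_ : i ∈ Finset.univ) => hstep i
  rw [Finset.sum_add_distrib, Finset.sum_add_distrib, ← Finset.mul_sum,
    Fin.sum_univ_eq_sum_range (fun i : ℕ => if i < stageOne K H then (1 : ℝ) else 0)] at h1
  have h2 : ∑ i ∈ Finset.range n, (if i < stageOne K H then (1 : ℝ) else 0) ≤ stageOne K H := by
    rw [← Finset.sum_filter, Finset.sum_const, nsmul_eq_mul, mul_one]
    have : ((Finset.range n).filter (· < stageOne K H)) ⊆ Finset.range (stageOne K H) :=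
      fun i hi => Finset.mem_range.2 (Finset.mem_filter.1 hi).2
    have := Finset.card_le_card this
    rw [Finset.card_range] at this
    exact_mod_cast this
  have h3 := (sum_one_div_sqrt_pulls_le H x).trans
    (mul_le_mul_of_nonneg_left (sum_sqrt_count_le H x) (by norm_num))
  have h4 := mul_le_mul_of_nonneg_left h3 (by positivity : 0 ≤ 4 * Real.sqrt (Real.log H))
  have h5 : 4 * Real.sqrt (Real.log H) * (3 * Real.sqrt (K * n)) =
      12 * Real.sqrt (K * n * Real.log H) := by
    rw [Real.sqrt_mul (by positivity : (0 : ℝ) ≤ K * n)]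
    ring
  rw [h5] at h4
  unfold regret
  linarith

/-- The event that the trust set is not identified or that some arm deviates at some time. -/
def badEvent (H : ℕ) : Set (History K H) :=
  {x | estTrustSet K H (fun i => (x i).2.1) ≠ B.trustSet} ∪
    ⋃ i : Fin H, {x | B.Deviates H (x.take i i.is_lt.le)}

lemma law_badEvent_le {H : ℕ} (hK : 2 ≤ K) (hH : 2 ≤ H) (h : stageOne K H ≤ H) :
    B.law (trustAwareUCB K H hK) H (B.badEvent H) ≤ ENNReal.ofReal (3 * K / H) := by
  have hH0 : (0 : ℝ) < H := by exact_mod_cast (by omega : 0 < H)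
  have hH1 : (1 : ℝ) ≤ H := by exact_mod_cast (by omega : 1 ≤ H)
  have h1 := B.law_estTrustSet_ne hK hH h
  have h2 (i : Fin H) : B.law (trustAwareUCB K H hK) H {x | B.Deviates H (x.take i i.is_lt.le)} ≤
      2 * K * H * ENNReal.ofReal (Real.exp (-(8 * Real.log H))) := by
    have h3 := Measure.le_map_apply (μ := B.law (trustAwareUCB K H hK) H)
      (History.measurable_take i.is_lt.le).aemeasurable {x : History K i | B.Deviates H x}
    rw [B.map_take_law _ i.is_lt.le] at h3
    refine h3.trans ((B.law_deviates_le _ H i).trans ?_)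
    have : (i : ℕ) ≤ H := i.is_lt.le
    gcongr
  calc _ ≤ K * ENNReal.ofReal (Real.exp (-Real.log H)) +
        ∑ i : Fin H, 2 * K * H * ENNReal.ofReal (Real.exp (-(8 * Real.log H))) :=
        (measure_union_le _ _).trans (add_le_add h1
          ((measure_iUnion_fintype_le _ _).trans (Finset.sum_le_sum fun i _ => h2 i)))
    _ = ENNReal.ofReal (K * Real.exp (-Real.log H) +
          H * (2 * K * H * Real.exp (-(8 * Real.log H)))) := by
        rw [Finset.sum_const, Finset.card_univ, Fintype.card_fin, nsmul_eq_mul,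
          ENNReal.ofReal_add (by positivity) (by positivity),
          ENNReal.ofReal_mul (by positivity), ENNReal.ofReal_mul (by positivity),
          ENNReal.ofReal_mul (by positivity), ENNReal.ofReal_mul (by positivity),
          ENNReal.ofReal_mul (by positivity)]
        simp
    _ ≤ _ := ENNReal.ofReal_le_ofReal ?_
  have e1 : Real.exp (-Real.log H) = 1 / H := by
    rw [Real.exp_neg, Real.exp_log hH0, one_div]
  -- The union over arms, times and numbers of pulls costs a factor `2 * K * H ^ 2`.
  have e2 : Real.exp (-(8 * Real.log H)) ≤ 1 / H * (1 / H) * (1 / H) := by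
    rw [← e1, ← Real.exp_add, ← Real.exp_add, Real.exp_le_exp]
    linarith [Real.log_natCast_nonneg H]
  calc _ ≤ K * (1 / (H : ℝ)) + H * (2 * K * H * (1 / H * (1 / H) * (1 / H))) := by
        rw [e1]
        gcongr
    _ = 3 * K / H := by
        field_simp
        ring

/-- The three parts of the expected regret: the first stage, the recommendations that are not
followed, and the regret of the upper confidence bounds. -/
lemma expectedRegret_le {H : ℕ} (hK : 2 ≤ K) (hH : 2 ≤ H) (hB : B.Consistent)
    (h : stageOne K H ≤ H) :
    B.expectedRegret (trustAwareUCB K H hK) H ≤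
      stageOne K H + 12 * Real.sqrt (K * H * Real.log H) + 3 * K +
        ∑ i : Fin H, (1 + (stageOne K H : ℝ)) / (i + 2) := by
  classical
  have hH0 : (0 : ℝ) < H := by exact_mod_cast (by omega : 0 < H)
  have hT : B.trustSet.Nonempty := let ⟨a, ha, _⟩ := hB; ⟨a, ha⟩
  set μ := B.law (trustAwareUCB K H hK) H with hμ
  set A : ℝ := stageOne K H + 12 * Real.sqrt (K * H * Real.log H) with hA
  have hA0 : 0 ≤ A := by positivity
  -- Measurable hulls have the same measure, and spare the measurability of the two kinds of events.
  let E := toMeasurable μ (B.badEvent H)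
  let F : Fin H → Set (History K H) := fun i => toMeasurable μ {x | B.NotFollowed H i x}
  have hE : MeasurableSet E := measurableSet_toMeasurable _ _
  have hF (i : Fin H) : MeasurableSet (F i) := measurableSet_toMeasurable _ _
  have hpt : ∀ᵐ x ∂μ, B.regret x ≤
      A + H * E.indicator 1 x + ∑ i, (F i).indicator 1 x := by
    filter_upwards [B.ae_recommended_candidates hK H] with x hx
    have hFs : ∑ i, (if B.NotFollowed H i x then (1 : ℝ) else 0) ≤
        ∑ i, (F i).indicator 1 x := by
      refine Finset.sum_le_sum fun i _ => ?_
      split_ifs with hi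
      · rw [Set.indicator_of_mem (subset_toMeasurable μ {x | B.NotFollowed H i x} hi)]
        rfl
      · exact Set.indicator_nonneg (fun _ _ => zero_le_one) x
    have hFs0 : 0 ≤ ∑ i, (if B.NotFollowed H i x then (1 : ℝ) else 0) :=
      Finset.sum_nonneg fun i _ => by split_ifs <;> norm_num
    by_cases hbad : x ∈ B.badEvent H
    · rw [Set.indicator_of_mem (subset_toMeasurable μ (B.badEvent H) hbad), Pi.one_apply, mul_one]
      linarith [B.regret_le hB x]
    · have h1 : 0 ≤ H * E.indicator (1 : History K H → ℝ) x :=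
        mul_nonneg hH0.le (Set.indicator_nonneg (fun _ _ => zero_le_one) x)
      simp only [badEvent, Set.mem_union, Set.mem_iUnion, not_or, not_exists] at hbad
      have h2 := B.regret_le_of_good hH hB hx (not_not.1 hbad.1) hbad.2
      linarith
  have hIE : Integrable (E.indicator (1 : History K H → ℝ)) μ :=
    (integrable_const (1 : ℝ)).indicator hE
  have hIF (i : Fin H) : Integrable ((F i).indicator (1 : History K H → ℝ)) μ :=
    (integrable_const (1 : ℝ)).indicator (hF i)
  have hIs : Integrable (fun x => ∑ i, (F i).indicator (1 : History K H → ℝ) x) μ :=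
    integrable_finsetSum _ fun i _ => hIF i
  have hIE' : Integrable (fun x => A + H * E.indicator (1 : History K H → ℝ) x) μ :=
    (integrable_const A).add (hIE.const_mul _)
  refine (integral_mono_ae (B.integrable_regret _ H) (hIE'.add hIs) hpt).trans ?_
  have hint : ∫ x, ((fun x => A + H * E.indicator (1 : History K H → ℝ) x) +
      fun x => ∑ i, (F i).indicator (1 : History K H → ℝ) x) x ∂μ =
      A + H * μ.real E + ∑ i, μ.real (F i) := by
    rw [integral_add' hIE' hIs, integral_add (integrable_const A) (hIE.const_mul _),
      integral_const_mul, integral_indicator_one hE, integral_finsetSum _ fun i _ => hIF i]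
    simp only [integral_indicator_one (hF _), integral_const, probReal_univ, one_smul]
  rw [hint]
  have hμE : H * μ.real E ≤ 3 * K := by
    have h1 : μ.real E ≤ 3 * K / H := by
      refine ENNReal.toReal_le_of_le_ofReal (by positivity) ?_
      rw [measure_toMeasurable]
      exact B.law_badEvent_le hK hH h
    calc H * μ.real E ≤ H * (3 * K / H) := mul_le_mul_of_nonneg_left h1 hH0.le
      _ = 3 * K := by field_simp
  have hμF (i : Fin H) : μ.real (F i) ≤ (1 + stageOne K H) / (i + 2) := by
    refine ENNReal.toReal_le_of_le_ofReal (by positivity) ?_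
    rw [measure_toMeasurable]
    exact B.law_not_follow_le hK hT i.is_lt
  have := Finset.sum_le_sum fun i (_ : i ∈ Finset.univ) => hμF i
  linarith

end Bandit

lemma stageOne_le (K H : ℕ) : (stageOne K H : ℝ) ≤ 60 * (K : ℝ) ^ 4 * Real.log H + 2 * K := by
  have h := (Nat.ceil_lt_add_one (a := 30 * (K : ℝ) ^ 3 * Real.log H)
    (mul_nonneg (by positivity) (Real.log_natCast_nonneg H))).le
  have h2 := mul_le_mul_of_nonneg_right h (by positivity : (0 : ℝ) ≤ 2 * K)
  have h3 : (stageOne K H : ℝ) = halfRound K H * (2 * K) := by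
    unfold stageOne; push_cast; ring
  rw [h3]
  refine h2.trans (le_of_eq ?_)
  ring

lemma sum_one_div_add_two_le (H : ℕ) : ∑ i : Fin H, 1 / ((i : ℝ) + 2) ≤ 1 + Real.log H := by
  refine le_trans ?_ (harmonic_le_one_add_log H)
  rw [Fin.sum_univ_eq_sum_range (fun i : ℕ => 1 / ((i : ℝ) + 2)), harmonic]
  push_cast
  refine Finset.sum_le_sum fun i _ => ?_
  rw [← one_div]
  gcongr
  norm_num

end TrustMAB

end

theorem theorem2 :
    ∃ C₁ C₂ : ℝ, 0 < C₁ ∧ 0 < C₂ ∧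
      ∀ (K H : ℕ) (hK : 2 ≤ K), 2 ≤ H →
        ∀ B : TrustMAB.Bandit K, B.Consistent →
          B.expectedRegret (TrustMAB.trustAwareUCB K H hK) H ≤
            C₁ * Real.sqrt (K * H * Real.log H) + C₂ * (K : ℝ) ^ 4 * Real.log H ^ 2 := by
  refine ⟨12, 250, by norm_num, by norm_num, fun K H hK hH B hB => ?_⟩
  have hL := TrustMAB.lt_log_of_two_le hH
  have hK2 : (2 : ℝ) ≤ K := by exact_mod_cast hK
  have hs := TrustMAB.stageOne_le K H
  set L := Real.log H with hL_def
  have hQ : (K : ℝ) ≤ 1 / 8 * (K : ℝ) ^ 4 := by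
    have := pow_le_pow_left₀ (by norm_num) hK2 3
    nlinarith
  have hQ1 : (16 : ℝ) ≤ (K : ℝ) ^ 4 := by linarith [pow_le_pow_left₀ (by norm_num) hK2 4]
  set Q := (K : ℝ) ^ 4 with hQ_def
  have hQL : Q ≤ 3 / 2 * (Q * L) := by nlinarith
  have hQLL : Q * L ≤ 3 / 2 * (Q * L ^ 2) := by nlinarith
  have hs' : (TrustMAB.stageOne K H : ℝ) ≤ 60.4 * (Q * L) := by linarith
  have hsq : 0 ≤ 12 * Real.sqrt (K * H * L) := by positivity
  -- A horizon within the first stage is covered by the term of order `K ^ 4`.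
  rcases le_total H (TrustMAB.stageOne K H) with h | h
  · have h1 : B.expectedRegret (TrustMAB.trustAwareUCB K H hK) H ≤ H := by
      refine (integral_mono (B.integrable_regret _ H) (integrable_const (H : ℝ))
        fun x => B.regret_le hB x).trans ?_
      simp
    have h2 : (H : ℝ) ≤ TrustMAB.stageOne K H := by exact_mod_cast h
    have h3 : 0 ≤ Q * L ^ 2 := by positivity
    linarith
  · have h1 := B.expectedRegret_le hK hH hB h
    have h2 : ∑ i : Fin H, (1 + (TrustMAB.stageOne K H : ℝ)) / (i + 2) ≤
        (1 + TrustMAB.stageOne K H) * (1 + L) := by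
      refine le_trans (le_of_eq ?_) (mul_le_mul_of_nonneg_left
        (TrustMAB.sum_one_div_add_two_le H) (by positivity))
      rw [Finset.mul_sum]
      exact Finset.sum_congr rfl fun i _ => by rw [mul_one_div]
    have h3 : (1 + (TrustMAB.stageOne K H : ℝ)) * (1 + L) ≤ 60.6 * (Q * L) * (2.45 * L) :=
      mul_le_mul (by linarith) (by linarith) (by linarith) (by positivity)
    have h4 : 60.6 * (Q * L) * (2.45 * L) = 148.47 * (Q * L ^ 2) := by ring
    linarith
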